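/- Let $\theta\in\mathbb R\setminus\mathbb Q$ and let $F(z,w)=(z+\cdots,\;e^{2\pi i\theta}w+\cdots)$ be a quasi-parabolic germ of holomorphic diffeomorphism of $\mathbb C^2$ at $0$ (the dots denote terms of order at least $2$), represented by a holomorphic map on an open neighbourhood $D$ of $0$. Such an $F$ is formally conjugate (by an invertible formal power series map of $\mathbb C^2$ fixing $0$) to a normal form $$\hat F(z,w)=\Bigl(z+\sum_{j\ge 2}a_jz^j,\; e^{2\pi i\theta}w+\sum_{j\ge 1}b_jz^jw\Bigr).$$ Let $\nu=\nu(F)$ be the least $j\ge 2$ with $a_j\ne 0$ and $\mu$ the least $j\ge 1$ with $b_j\neq 0$ (each being $\infty$ if there is no such $j$). The number $\nu(F)$ and, when $\nu<\infty$, the condition $\nu-\mu-1\le 0$ do not depend on the normal form chosen; $F$ is called dynamically separating if $\nu<\infty$ and $\nu-\mu-1\le 0$. A basin of attraction of $F$ at $0$ is a nonempty open set $U\subset D$ with $0\in\overline U$ for which there is a neighbourhood basis $\{\Omega_j\}$ of $0$ such that, for all $j$, $F(U\cap\Omega_j)\subset U\cap\Omega_j$ and $F^{\circ m}(p)\to 0$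 as $m\to\infty$ for all $p\in U\cap\Omega_j$. Suppose that $F$ is dynamically separating and formally conjugate to $\hat F$ as above, and that $$\operatorname{Re}\left(\frac{b_{\nu-1}}{e^{2\pi i\theta}a_\nu}\right)>0 .$$ Then there exist $\nu(F)-1$ pairwise disjoint connected basins of attraction of $F$ at $0$. -/

import Mathlib

open Filter Topology

noncomputable section

/-- A formal self-map of `ℂ²`: a pair of formal power series in two variables. -/
abbrev FormalMap : Type := Fin 2 → MvPowerSeries (Fin 2) ℂ

/-- Composition `A ∘ B` of formal maps. It is meaningful when `B` has no constant term. -/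
def FormalMap.comp (A B : FormalMap) : FormalMap :=
  fun i => MvPowerSeries.subst B (A i)

/-- A formal diffeomorphism of `ℂ²` fixing the origin: no constant term, invertible linear part. -/
def FormalMap.IsDiffeo (Φ : FormalMap) : Prop :=
  (∀ i, MvPowerSeries.constantCoeff (Φ i) = 0) ∧
    (Matrix.of fun i j : Fin 2 => MvPowerSeries.coeff (Finsupp.single j 1) (Φ i)).det ≠ 0

/-- `P` is the Taylor expansion at the origin of the map `F`: near `0`, each component of `F` is the
sum of the corresponding power series. -/
def IsTaylorExpansion (F : (Fin 2 → ℂ) → (Fin 2 → ℂ)) (P : FormalMap) : Prop :=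
  ∀ᶠ z in 𝓝 (0 : Fin 2 → ℂ), ∀ i,
    HasSum (fun n : Fin 2 →₀ ℕ => MvPowerSeries.coeff n (P i) * ∏ j, z j ^ n j) (F z i)

/-- The germ of `F` at `0` is formally conjugate to the formal map `G`: its Taylor expansion `P`
satisfies `Φ ∘ P = G ∘ Φ` for some formal diffeomorphism `Φ`. -/
def IsFormallyConjugate (F : (Fin 2 → ℂ) → (Fin 2 → ℂ)) (G : FormalMap) : Prop :=
  ∃ P Φ : FormalMap, IsTaylorExpansion F P ∧ Φ.IsDiffeo ∧ Φ.comp P = G.comp Φ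

/-- The number `e^{2πiθ}`. -/
def unitEigenvalue (θ : ℝ) : ℂ := Complex.exp (2 * Real.pi * Complex.I * θ)

/-- `F`, holomorphic on the open set `D ∋ 0`, represents a quasi-parabolic germ
`F(z, w) = (z + ⋯, e^{2πiθ} w + ⋯)`, the dots being terms of order at least two. -/
structure IsQuasiParabolic (θ : ℝ) (D : Set (Fin 2 → ℂ)) (F : (Fin 2 → ℂ) → (Fin 2 → ℂ)) :
    Prop where
  isOpen : IsOpen D
  zero_mem : (0 : Fin 2 → ℂ) ∈ D
  differentiableOn : DifferentiableOn ℂ F D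
  map_zero : F 0 = 0
  fderiv_zero : ∀ v : Fin 2 → ℂ, fderiv ℂ F 0 v = ![v 0, unitEigenvalue θ * v 1]

/-- The formal normal form
`(z, w) ↦ (z + ∑_{j ≥ 2} a_j z^j, e^{2πiθ} w + ∑_{j ≥ 1} b_j z^j w)`, given by its coefficients.
The values `a 0`, `a 1` and `b 0` are not used. -/
def quasiParabolicNormalForm (θ : ℝ) (a b : ℕ → ℂ) : FormalMap :=
  ![fun n => if n 1 = 0 then (if n 0 = 0 then 0 else if n 0 = 1 then 1 else a (n 0)) else 0,
    fun n => if n 1 = 1 then (if n 0 = 0 then unitEigenvalue θ else b (n 0)) else 0]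

/-- The least `j ≥ 2` with `a j ≠ 0`, or `∞` if there is none. -/
def normalFormNu (a : ℕ → ℂ) : ℕ∞ := ⨅ (j : ℕ) (_ : 2 ≤ j ∧ a j ≠ 0), (j : ℕ∞)

/-- The least `j ≥ 1` with `b j ≠ 0`, or `∞` if there is none. -/
def normalFormMu (b : ℕ → ℂ) : ℕ∞ := ⨅ (j : ℕ) (_ : 1 ≤ j ∧ b j ≠ 0), (j : ℕ∞)

/-- `F` is dynamically separating: `ν < ∞` and `ν - μ - 1 ≤ 0`, where `ν` and `μ` are read off a
formal normal form of `F` (the condition does not depend on which one). -/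
def IsDynamicallySeparating (θ : ℝ) (F : (Fin 2 → ℂ) → (Fin 2 → ℂ)) : Prop :=
  (∃ a b : ℕ → ℂ, IsFormallyConjugate F (quasiParabolicNormalForm θ a b)) ∧
    ∀ a b : ℕ → ℂ, IsFormallyConjugate F (quasiParabolicNormalForm θ a b) →
      normalFormNu a < ⊤ ∧ normalFormNu a ≤ normalFormMu b + 1

/-- `U` is a basin of attraction at `0` of the map `F` defined on `D`: a nonempty open subset of
`D`, with `0` in its closure, for which there is a neighbourhood basis `B` of `0` such that, for
every `Ω ∈ B`, `F` maps `U ∩ Ω` into itself and the orbits starting in `U ∩ Ω` converge to `0`. -/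
structure IsBasinOfAttraction (D : Set (Fin 2 → ℂ)) (F : (Fin 2 → ℂ) → (Fin 2 → ℂ))
    (U : Set (Fin 2 → ℂ)) : Prop where
  nonempty : U.Nonempty
  isOpen : IsOpen U
  subset : U ⊆ D
  zero_mem_closure : (0 : Fin 2 → ℂ) ∈ closure U
  exists_basis : ∃ B : Set (Set (Fin 2 → ℂ)),
    (𝓝 (0 : Fin 2 → ℂ)).HasBasis (fun Ω => Ω ∈ B) id ∧
      ∀ Ω ∈ B, Set.MapsTo F (U ∩ Ω) (U ∩ Ω) ∧
        ∀ z ∈ U ∩ Ω, Tendsto (fun m : ℕ => F^[m] z) atTop (𝓝 0)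

end

/-!
Truncating the formal conjugacy at a high order gives a chart in which `F` agrees with its normal
form `(z, w) ↦ (z + a z ^ (m + 1) + ⋯, (l + b z ^ m + ⋯) w)`, where `m = ν - 1`, `a = a_ν`,
`b = b_{ν - 1}` and `|l| = 1`, up to an error of order `N` in `(z, w)`. In the cusp `|w| < |z| ^ σ`
such an error is negligible once `σ N ≥ m + 2`, so that `z` moves as under a one-dimensional
parabolic germ: the Fatou coordinate `Z = -1 / (m a z ^ m)` increases by about `1` at each step, and
a narrow cone around the positive real `Z`-axis gives `m` petals, one around each attracting
direction. For `Z` in that cone, `z ^ m` is almost a negative multiple of `1 / a`, and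
`Re (b / (l a)) > 0` yields `|l + b z ^ m| ≤ 1 - c |z| ^ m`. As `|z|` itself shrinks at most by the
factor `1 - 2 |a| |z| ^ m`, the cusp over each petal is invariant when `2 |a| σ < c`.
-/

noncomputable section

open Asymptotics MvPowerSeries

/-! ### Jets of functions and formal power series -/

section Jets

variable {𝕜 ι κ : Type*} [Fintype ι]

section NormedField

variable [NormedField 𝕜]

lemma norm_prod_pow_le_pow_degree (n : ι →₀ ℕ) (x : ι → 𝕜) :
    ‖∏ j, x j ^ n j‖ ≤ ‖x‖ ^ n.degree := by
  rw [norm_prod, Finsupp.degree_eq_sum, ← Finset.prod_pow_eq_pow_sum]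
  refine Finset.prod_le_prod (fun _ _ => norm_nonneg _) fun j _ => ?_
  rw [norm_pow]
  exact pow_le_pow_left₀ (norm_nonneg _) (norm_le_pi_norm x j) _

lemma isBigO_norm_pow_of_le {E : Type*} [SeminormedAddCommGroup E] {k N : ℕ} (h : k ≤ N) :
    (fun x : E => ‖x‖ ^ N) =O[𝓝 0] fun x => ‖x‖ ^ k := by
  refine IsBigO.of_bound 1 ?_
  filter_upwards [Metric.ball_mem_nhds (0 : E) one_pos] with x hx
  simpa using pow_le_pow_of_le_one (norm_nonneg x) (mem_ball_zero_iff.mp hx).le h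

lemma isBigO_eval_of_coeff_eq_zero {N : ℕ} {p : MvPolynomial ι 𝕜}
    (hp : ∀ n : ι →₀ ℕ, n.degree < N → p.coeff n = 0) :
    (fun x => MvPolynomial.eval x p) =O[𝓝 0] fun x : ι → 𝕜 => ‖x‖ ^ N := by
  simp only [MvPolynomial.eval_eq']
  refine IsBigO.fun_sum fun n hn => ?_
  have hN : N ≤ n.degree := by
    by_contra! h
    exact MvPolynomial.mem_support_iff.mp hn (hp n h)
  refine IsBigO.trans (.of_bound ‖p.coeff n‖ (.of_forall fun x => ?_)) (isBigO_norm_pow_of_le hN)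
  rw [norm_mul, norm_pow, norm_norm]
  gcongr
  exact norm_prod_pow_le_pow_degree n x

/-- `f` has the power series `A` as Taylor polynomial at the origin, up to an error of order `N`. -/
def HasJet (N : ℕ) (f : (ι → 𝕜) → 𝕜) (A : MvPowerSeries ι 𝕜) : Prop :=
  (fun x => f x - MvPolynomial.eval x (A.truncTotal N)) =O[𝓝 0] fun x => ‖x‖ ^ N

lemma hasJet_eval {N : ℕ} {p : MvPolynomial ι 𝕜} {A : MvPowerSeries ι 𝕜}
    (h : ∀ n : ι →₀ ℕ, n.degree < N → p.coeff n = coeff n A) :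
    HasJet N (fun x => MvPolynomial.eval x p) A := by
  simp only [HasJet, ← map_sub]
  refine isBigO_eval_of_coeff_eq_zero fun n hn => ?_
  rw [MvPolynomial.coeff_sub, coeff_truncTotal _ hn, h n hn, sub_self]

namespace HasJet

variable {k N : ℕ} {f g : (ι → 𝕜) → 𝕜} {A B : MvPowerSeries ι 𝕜}

lemma congr_truncTotal (hf : HasJet N f A) (hAB : A.truncTotal N = B.truncTotal N) :
    HasJet N f B := by
  rwa [HasJet, ← hAB]

lemma sub_isBigO (hf : HasJet N f A) (hg : HasJet N g A) :
    (fun x => f x - g x) =O[𝓝 0] fun x => ‖x‖ ^ N :=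
  (IsBigO.sub hf hg).congr_left fun x => by ring

lemma isBigO_norm_pow (hf : HasJet N f A) (hk : k ≤ N)
    (hA : ∀ n : ι →₀ ℕ, n.degree < k → coeff n A = 0) :
    f =O[𝓝 0] fun x => ‖x‖ ^ k := by
  have htrunc : (fun x => MvPolynomial.eval x (A.truncTotal N)) =O[𝓝 0] fun x => ‖x‖ ^ k :=
    isBigO_eval_of_coeff_eq_zero fun n hn => by
      rw [coeff_truncTotal _ (hn.trans_le hk), hA n hn]
  exact ((hf.trans (isBigO_norm_pow_of_le hk)).add htrunc).congr_left fun x => by ring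

lemma isBigO_one (hf : HasJet N f A) : f =O[𝓝 0] fun _ => (1 : ℝ) := by
  simpa only [pow_zero] using hf.isBigO_norm_pow N.zero_le fun _ hn => (Nat.not_lt_zero _ hn).elim

lemma isBigO_norm (hf : HasJet N f A) (hN : N ≠ 0) (hA : constantCoeff A = 0) :
    f =O[𝓝 0] fun x => ‖x‖ := by
  simpa only [pow_one] using hf.isBigO_norm_pow (Nat.one_le_iff_ne_zero.mpr hN) fun n hn => by
    rwa [(Finsupp.degree_eq_zero_iff n).mp (Nat.lt_one_iff.mp hn),
      coeff_zero_eq_constantCoeff_apply]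

lemma tendsto_zero (hf : HasJet N f A) (hN : N ≠ 0) (hA : constantCoeff A = 0) :
    Tendsto f (𝓝 0) (𝓝 0) :=
  (hf.isBigO_norm hN hA).trans_tendsto tendsto_norm_zero

lemma apply_zero (hf : HasJet N f A) (hN : N ≠ 0) : f 0 = constantCoeff A := by
  have h : f 0 - MvPolynomial.eval 0 (A.truncTotal N) = 0 :=
    IsBigO.eq_zero_of_norm_pow (f := fun x => f x - MvPolynomial.eval x (A.truncTotal N))
      (by simpa only [sub_zero] using! hf) hN
  rw [sub_eq_zero.mp h, MvPolynomial.eval_zero, constantCoeff_truncTotal_eq_ite,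
    if_pos (Nat.pos_of_ne_zero hN)]

lemma const (N : ℕ) (c : 𝕜) : HasJet N (fun _ : ι → 𝕜 => c) (C c) := by
  simpa only [MvPolynomial.eval_C] using hasJet_eval (p := MvPolynomial.C c) fun n _ => by
    rw [← MvPolynomial.coe_C, MvPolynomial.coeff_coe]

lemma add (hf : HasJet N f A) (hg : HasJet N g B) :
    HasJet N (fun x => f x + g x) (A + B) :=
  (IsBigO.add hf hg).congr_left fun x => by rw [map_add, map_add]; ring

lemma mul (hf : HasJet N f A) (hg : HasJet N g B) :
    HasJet N (fun x => f x * g x) (A * B) := by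
  set p := A.truncTotal N
  set q := B.truncTotal N
  have hpq : HasJet N (fun x => MvPolynomial.eval x (p * q)) (A * B) :=
    hasJet_eval fun n hn => coeff_truncTotal_mul_truncTotal_eq_coeff_mul _ _ hn
  have hp : (fun x => MvPolynomial.eval x p) =O[𝓝 0] fun _ : ι → 𝕜 => (1 : ℝ) :=
    (hasJet_eval fun n hn => coeff_truncTotal A hn).isBigO_one
  have h₁ : (fun x => (f x - MvPolynomial.eval x p) * g x) =O[𝓝 0] fun x => ‖x‖ ^ N := by
    simpa only [mul_one] using IsBigO.mul hf hg.isBigO_one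
  have h₂ : (fun x => MvPolynomial.eval x p * (g x - MvPolynomial.eval x q)) =O[𝓝 0]
      fun x => ‖x‖ ^ N := by
    simpa only [one_mul] using hp.mul hg
  refine ((h₁.add h₂).add hpq).congr_left fun x => ?_
  simp only [map_mul (MvPolynomial.eval x)]; ring

lemma eval_aeval {f : (ι → 𝕜) → κ → 𝕜} {A : κ → MvPowerSeries ι 𝕜}
    (hf : ∀ i, HasJet N (fun x => f x i) (A i)) (p : MvPolynomial κ 𝕜) :
    HasJet N (fun x => MvPolynomial.eval (f x) p) (MvPolynomial.aeval A p) := by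
  induction p using MvPolynomial.induction_on with
  | C c => simpa [MvPowerSeries.algebraMap_apply] using const N c
  | add p q hp hq => simpa using hp.add hq
  | mul_X p i hp => simpa using hp.mul (hf i)

lemma comp [Fintype κ] {f : (κ → 𝕜) → ι → 𝕜} {A : ι → MvPowerSeries κ 𝕜}
    (hg : HasJet N g B) (hN : N ≠ 0) (hf : ∀ i, HasJet N (fun x => f x i) (A i))
    (hA : ∀ i, constantCoeff (A i) = 0) :
    HasJet N (fun x => g (f x)) (B.subst A) := by
  have hfO : f =O[𝓝 0] fun x => ‖x‖ := isBigO_pi.mpr fun i => (hf i).isBigO_norm hN (hA i)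
  have hf0 : Tendsto f (𝓝 0) (𝓝 0) :=
    tendsto_pi_nhds.mpr fun i => (hf i).tendsto_zero hN (hA i)
  have herr : (fun x => g (f x) - MvPolynomial.eval (f x) (B.truncTotal N)) =O[𝓝 0]
      fun x => ‖x‖ ^ N :=
    (IsBigO.comp_tendsto hg hf0).trans (hfO.norm_left.pow N)
  have hpoly : HasJet N (fun x => MvPolynomial.eval (f x) (B.truncTotal N)) (B.subst A) := by
    refine (eval_aeval hf _).congr_truncTotal ?_
    rw [← subst_coe, ← truncTotal_subst_eq_truncTotal_truncTotal_subst hA]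
  exact (herr.add hpoly).congr_left fun x => by ring

end HasJet

end NormedField

section RCLike

variable [RCLike 𝕜] {f : (ι → 𝕜) → 𝕜} {A : MvPowerSeries ι 𝕜}

lemma hasSum_coeff_mul_prod_pow (p : MvPolynomial ι 𝕜) (x : ι → 𝕜) :
    HasSum (fun n : ι →₀ ℕ => p.coeff n * ∏ j, x j ^ n j) (MvPolynomial.eval x p) := by
  rw [MvPolynomial.eval_eq']
  exact hasSum_sum_of_ne_finset_zero fun n hn => by
    rw [MvPolynomial.notMem_support_iff.mp hn, zero_mul]

lemma exists_summable_norm_coeff_mul_pow_degree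
    (h : ∀ᶠ x in 𝓝 (0 : ι → 𝕜), Summable fun n : ι →₀ ℕ => coeff n A * ∏ j, x j ^ n j) :
    ∃ r : ℝ, 0 < r ∧ Summable fun n : ι →₀ ℕ => ‖coeff n A‖ * r ^ n.degree := by
  have hdiag : Tendsto (fun t : ℝ => fun _ : ι => (t : 𝕜)) (𝓝[>] 0) (𝓝 0) := by
    refine tendsto_nhdsWithin_of_tendsto_nhds (tendsto_pi_nhds.mpr fun _ => ?_)
    simpa using (RCLike.continuous_ofReal (K := 𝕜)).tendsto 0
  obtain ⟨r, hsum, hr⟩ := ((hdiag.eventually h).and self_mem_nhdsWithin).exists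
  refine ⟨r, hr, hsum.norm.congr fun n => ?_⟩
  rw [norm_mul, Finset.prod_pow_eq_pow_sum, ← Finsupp.degree_eq_sum, norm_pow, RCLike.norm_ofReal,
    abs_of_pos hr]

lemma isBigO_of_eventually_hasSum {N : ℕ}
    (h : ∀ᶠ x in 𝓝 0, HasSum (fun n : ι →₀ ℕ => coeff n A * ∏ j, x j ^ n j) (f x))
    (hA : ∀ n : ι →₀ ℕ, n.degree < N → coeff n A = 0) :
    f =O[𝓝 0] fun x => ‖x‖ ^ N := by
  obtain ⟨r, hr, hsum⟩ :=
    exists_summable_norm_coeff_mul_pow_degree (h.mono fun _ hx => hx.summable)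
  set S := ∑' n : ι →₀ ℕ, ‖coeff n A‖ * r ^ n.degree
  refine IsBigO.of_bound (S / r ^ N) ?_
  filter_upwards [h, Metric.ball_mem_nhds 0 hr] with x hx hxr
  have hxr : ‖x‖ / r ≤ 1 := (div_le_one hr).mpr (mem_ball_zero_iff.mp hxr).le
  have hterm (n : ι →₀ ℕ) :
      ‖coeff n A * ∏ j, x j ^ n j‖ ≤ ‖coeff n A‖ * r ^ n.degree * (‖x‖ / r) ^ N := by
    rcases lt_or_ge n.degree N with hn | hn
    · simp [hA n hn]
    calc ‖coeff n A * ∏ j, x j ^ n j‖ ≤ ‖coeff n A‖ * ‖x‖ ^ n.degree := by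
          rw [norm_mul]
          gcongr
          exact norm_prod_pow_le_pow_degree n x
      _ = ‖coeff n A‖ * r ^ n.degree * (‖x‖ / r) ^ n.degree := by
          rw [div_pow]; field_simp
      _ ≤ ‖coeff n A‖ * r ^ n.degree * (‖x‖ / r) ^ N := by
          gcongr ?_ * ?_
          exact pow_le_pow_of_le_one (by positivity) hxr hn
  calc ‖f x‖ ≤ S * (‖x‖ / r) ^ N := hx.norm_le_of_bounded (hsum.hasSum.mul_right _) hterm
    _ = S / r ^ N * ‖‖x‖ ^ N‖ := by rw [norm_pow, norm_norm, div_pow]; ring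

lemma hasJet_of_eventually_hasSum (N : ℕ)
    (h : ∀ᶠ x in 𝓝 0, HasSum (fun n : ι →₀ ℕ => coeff n A * ∏ j, x j ^ n j) (f x)) :
    HasJet N f A := by
  refine isBigO_of_eventually_hasSum (A := A - (A.truncTotal N : MvPowerSeries ι 𝕜))
    (h.mono fun x hx => ?_) fun n hn => ?_
  · simpa only [map_sub, MvPolynomial.coeff_coe, sub_mul] using
      hx.sub (hasSum_coeff_mul_prod_pow (A.truncTotal N) x)
  · rw [map_sub, MvPolynomial.coeff_coe, coeff_truncTotal _ hn, sub_self]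

end RCLike

section LinearPart

variable [NontriviallyNormedField 𝕜]

lemma HasJet.hasFDerivAt {N : ℕ} {f : (ι → 𝕜) → 𝕜} {A : MvPowerSeries ι 𝕜} (hf : HasJet N f A)
    (hN : 2 ≤ N) :
    HasFDerivAt f (∑ j, coeff (Finsupp.single j 1) A •
      ContinuousLinearMap.proj (R := 𝕜) (φ := fun _ : ι => 𝕜) j) 0 := by
  classical
  set p : MvPolynomial ι 𝕜 := MvPolynomial.C (constantCoeff A) +
    ∑ j, MvPolynomial.C (coeff (Finsupp.single j 1) A) * MvPolynomial.X j
  have hp : HasJet 2 (fun x => MvPolynomial.eval x p) (A.truncTotal N) := hasJet_eval fun n hn => by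
    rw [MvPolynomial.coeff_coe, coeff_truncTotal _ (hn.trans_le hN), MvPolynomial.coeff_add,
      MvPolynomial.coeff_sum]
    simp only [MvPolynomial.coeff_C_mul, MvPolynomial.coeff_X, MvPolynomial.coeff_C]
    have hn : n.degree = 0 ∨ n.degree = 1 := by omega
    rcases hn with hn | hn
    · simp [(Finsupp.degree_eq_zero_iff n).mp hn]
    · obtain ⟨j, rfl⟩ : n ∈ Set.range fun j : ι => Finsupp.single j 1 := by
        rwa [Finsupp.range_single_one]
      simp [Finsupp.single_left_inj, eq_comm]
  have htrunc : HasJet 2 (fun x => MvPolynomial.eval x (A.truncTotal N)) (A.truncTotal N) :=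
    hasJet_eval fun n _ => (MvPolynomial.coeff_coe _ n).symm
  have herr : (fun x => f x - MvPolynomial.eval x p) =O[𝓝 0] fun x => ‖x‖ ^ 2 :=
    ((IsBigO.trans hf (isBigO_norm_pow_of_le hN)).add (htrunc.sub_isBigO hp)).congr_left
      fun x => by ring
  have hlittle : (fun x : ι → 𝕜 => ‖x‖ ^ 2) =o[𝓝 0] fun x => x - 0 := by
    simpa only [sub_zero] using isLittleO_norm_pow_id (E' := ι → 𝕜) one_lt_two
  refine HasFDerivAt.of_isLittleO ((herr.trans_isLittleO hlittle).congr_left fun x => ?_)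
  rw [hf.apply_zero (by omega)]
  simp [p, sub_sub]

end LinearPart

end Jets

lemma IsTaylorExpansion.hasJet {F : (Fin 2 → ℂ) → Fin 2 → ℂ} {P : FormalMap}
    (h : IsTaylorExpansion F P) (N : ℕ) (i : Fin 2) : HasJet N (fun x => F x i) (P i) :=
  hasJet_of_eventually_hasSum N (h.mono fun _ hx => hx i)

/-- The polynomial map obtained by truncating a formal map at total degree `N`. -/
def FormalMap.truncMap (N : ℕ) (Φ : FormalMap) (x : Fin 2 → ℂ) : Fin 2 → ℂ :=
  fun i => MvPolynomial.eval x ((Φ i).truncTotal N)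

lemma FormalMap.hasJet_truncMap (N : ℕ) (Φ : FormalMap) (i : Fin 2) :
    HasJet N (fun x => Φ.truncMap N x i) (Φ i) :=
  hasJet_eval fun _ hn => coeff_truncTotal _ hn

/-- The linear part of a formal map. -/
def FormalMap.linearPart (Φ : FormalMap) : Matrix (Fin 2) (Fin 2) ℂ :=
  Matrix.of fun i j => coeff (Finsupp.single j 1) (Φ i)

lemma FormalMap.hasStrictFDerivAt_truncMap {N : ℕ} (hN : 2 ≤ N) (Φ : FormalMap) :
    HasStrictFDerivAt (Φ.truncMap N) (Matrix.toLin' Φ.linearPart).toContinuousLinearMap 0 := by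
  refine hasStrictFDerivAt_pi'.mpr fun i => ?_
  have hstrict := (AnalyticOnNhd.eval_mvPolynomial (𝕜 := ℂ) ((Φ i).truncTotal N) 0
    (Set.mem_univ _)).hasStrictFDerivAt
  have hfderiv := ((Φ.hasJet_truncMap N i).hasFDerivAt hN).fderiv
  refine hstrict.congr_fderiv (hfderiv.trans ?_)
  ext v
  fin_cases i <;> simp [FormalMap.linearPart]

lemma FormalMap.IsDiffeo.exists_openPartialHomeomorph {N : ℕ} (hN : 2 ≤ N) {Φ : FormalMap}
    (hΦ : Φ.IsDiffeo) :
    ∃ φ : OpenPartialHomeomorph (Fin 2 → ℂ) (Fin 2 → ℂ),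
      (φ : (Fin 2 → ℂ) → Fin 2 → ℂ) = Φ.truncMap N ∧
      0 ∈ φ.source ∧ φ 0 = 0 ∧ (fun x => x) =O[𝓝 0] φ := by
  have hunit : IsUnit Φ.linearPart.det := isUnit_iff_ne_zero.mpr hΦ.2
  let e : (Fin 2 → ℂ) ≃L[ℂ] (Fin 2 → ℂ) := (Φ.linearPart.toLinearEquiv'
    (Φ.linearPart.invertibleOfIsUnitDet hunit)).toContinuousLinearEquiv
  have hder : HasStrictFDerivAt (Φ.truncMap N) (e : (Fin 2 → ℂ) →L[ℂ] (Fin 2 → ℂ)) 0 :=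
    Φ.hasStrictFDerivAt_truncMap hN
  have hzero : Φ.truncMap N 0 = 0 :=
    funext fun i => ((Φ.hasJet_truncMap N i).apply_zero (by omega)).trans (hΦ.1 i)
  refine ⟨hder.toOpenPartialHomeomorph _, rfl, hder.mem_toOpenPartialHomeomorph_source, hzero, ?_⟩
  have hequiv : (fun x => Φ.truncMap N x - Φ.truncMap N 0) ~[𝓝 0] fun x => e (x - 0) :=
    hder.hasFDerivAt.isEquivalent_sub e.toHomeomorph.isInducing
  simpa only [hzero, sub_zero, hder.toOpenPartialHomeomorph_coe] using
    (e.isBigO_sub_rev (𝓝 0) 0).trans hequiv.isBigO_symm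

lemma single_zero_add_single_one_eq_iff {j e : ℕ} {n : Fin 2 →₀ ℕ} :
    Finsupp.single 0 j + Finsupp.single 1 e = n ↔ n 0 = j ∧ n 1 = e := by
  simp [Finsupp.ext_iff, Fin.forall_fin_two, eq_comm]

lemma hasJet_sum_range_mul_pow {𝕜 : Type*} [NormedField 𝕜] (N e : ℕ) (c : ℕ → 𝕜)
    {A : MvPowerSeries (Fin 2) 𝕜}
    (hA : ∀ n : Fin 2 →₀ ℕ, coeff n A = if n 1 = e then c (n 0) else 0) :
    HasJet N (fun y => (∑ j ∈ Finset.range N, c j * y 0 ^ j) * y 1 ^ e) A := by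
  set p : MvPolynomial (Fin 2) 𝕜 := ∑ j ∈ Finset.range N,
    MvPolynomial.monomial (Finsupp.single 0 j + Finsupp.single 1 e) (c j)
  have heval (y : Fin 2 → 𝕜) :
      MvPolynomial.eval y p = (∑ j ∈ Finset.range N, c j * y 0 ^ j) * y 1 ^ e := by
    simp [p, MvPolynomial.eval_monomial, Finsupp.prod_fintype, Fin.prod_univ_two, Finset.sum_mul,
      mul_assoc]
  simp only [← heval]
  refine hasJet_eval fun n hn => ?_
  have hn0 : n 0 < N := (Finsupp.le_degree 0 n).trans_lt hn
  simp only [p, MvPolynomial.coeff_sum, MvPolynomial.coeff_monomial,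
    single_zero_add_single_one_eq_iff, ite_and, Finset.sum_ite_eq, Finset.mem_range, hn0, if_true,
    hA n]

lemma isBigO_sum_range_sub_sum_range {𝕜 : Type*} [NormedField 𝕜] (c : ℕ → 𝕜) {k N : ℕ}
    (hk : k ≤ N) :
    (fun z : 𝕜 => ∑ j ∈ Finset.range N, c j * z ^ j - ∑ j ∈ Finset.range k, c j * z ^ j)
      =O[𝓝 0] fun z => ‖z‖ ^ k := by
  simp only [← Finset.sum_Ico_eq_sub _ hk]
  refine IsBigO.fun_sum fun j hj => IsBigO.const_mul_left ?_ _
  refine IsBigO.of_norm_left ?_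
  simpa only [norm_pow] using isBigO_norm_pow_of_le (Finset.mem_Ico.mp hj).1

/-- `G` has the form `(z, w) ↦ (z + a z ^ (m + 1) + ⋯, (l + b z ^ m) w + ⋯)`: the dots are terms of
higher order in `z`, which in the second component are divisible by `w`, and an error of order `N`
in `(z, w)`. -/
structure HasLeadingTerms (m N : ℕ) (l a b : ℂ) (G : (Fin 2 → ℂ) → Fin 2 → ℂ) : Prop where
  fst : (fun y => G y 0 - (y 0 + a * y 0 ^ (m + 1))) =O[𝓝 0]
    fun y => ‖y 0‖ ^ (m + 2) + ‖y‖ ^ N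
  snd : (fun y => G y 1 - (l + b * y 0 ^ m) * y 1) =O[𝓝 0]
    fun y => ‖y 0‖ ^ (m + 1) * ‖y 1‖ + ‖y‖ ^ N

lemma IsTaylorExpansion.constantCoeff {F : (Fin 2 → ℂ) → Fin 2 → ℂ} {P : FormalMap}
    (h : IsTaylorExpansion F P) (h0 : F 0 = 0) (i : Fin 2) :
    MvPowerSeries.constantCoeff (P i) = 0 := by
  rw [← (h.hasJet 1 i).apply_zero one_ne_zero, h0, Pi.zero_apply]

lemma IsTaylorExpansion.tendsto_zero {F : (Fin 2 → ℂ) → Fin 2 → ℂ} {P : FormalMap}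
    (h : IsTaylorExpansion F P) (h0 : F 0 = 0) : Tendsto F (𝓝 0) (𝓝 0) :=
  tendsto_pi_nhds.mpr fun i => (h.hasJet 1 i).tendsto_zero one_ne_zero (h.constantCoeff h0 i)

lemma IsFormallyConjugate.exists_chart {F : (Fin 2 → ℂ) → Fin 2 → ℂ} {H : FormalMap}
    (h : IsFormallyConjugate F H) (h0 : F 0 = 0) {N : ℕ} (hN : 2 ≤ N)
    {g : Fin 2 → (Fin 2 → ℂ) → ℂ} (hg : ∀ i, HasJet N (g i) (H i)) :
    ∃ φ : OpenPartialHomeomorph (Fin 2 → ℂ) (Fin 2 → ℂ), 0 ∈ φ.source ∧ φ 0 = 0 ∧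
      ∀ i, (fun y => φ (F (φ.symm y)) i - g i y) =O[𝓝 0] fun y => ‖y‖ ^ N := by
  obtain ⟨P, Φ, hP, hΦ, hcomp⟩ := h
  obtain ⟨φ, hφ, hsource, hφ0, hO⟩ := hΦ.exists_openPartialHomeomorph hN
  have hN0 : N ≠ 0 := by omega
  have hjet (i : Fin 2) : HasJet N (fun x => φ x i) (Φ i) := by
    rw [hφ]
    exact Φ.hasJet_truncMap N i
  refine ⟨φ, hsource, hφ0, fun i => ?_⟩
  have hleft : HasJet N (fun x => φ (F x) i) (Φ.comp P i) :=
    (hjet i).comp hN0 (hP.hasJet N) (hP.constantCoeff h0)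
  have hright : HasJet N (fun x => g i (φ x)) (H.comp Φ i) := (hg i).comp hN0 hjet hΦ.1
  have herr : (fun x => φ (F x) i - g i (φ x)) =O[𝓝 0] fun x => ‖φ x‖ ^ N :=
    (hleft.sub_isBigO (hcomp ▸ hright)).trans (hO.norm_norm.pow N)
  have htarget : 0 ∈ φ.target := hφ0 ▸ φ.map_source hsource
  have hsymm : Tendsto φ.symm (𝓝 0) (𝓝 0) := by
    have hsymm0 : φ.symm 0 = 0 := by simpa only [hφ0] using φ.left_inv hsource
    simpa only [ContinuousAt, hsymm0] using φ.symm.continuousAt htarget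
  refine (herr.comp_tendsto hsymm).congr' ?_ ?_ <;>
    filter_upwards [φ.open_target.mem_nhds htarget] with y hy <;>
    simp only [Function.comp_apply, φ.right_inv hy]

lemma sum_range_succ_eq_add {M : Type*} [AddCommMonoid M] {f : ℕ → M} {i m : ℕ} (hi : i < m)
    (hf : ∀ j < m, j ≠ i → f j = 0) : ∑ j ∈ Finset.range (m + 1), f j = f i + f m := by
  rw [Finset.sum_range_succ, Finset.sum_eq_single_of_mem i (Finset.mem_range.mpr hi)
    fun j hj => hf j (Finset.mem_range.mp hj)]

lemma IsFormallyConjugate.exists_hasLeadingTerms {F : (Fin 2 → ℂ) → Fin 2 → ℂ} {θ : ℝ}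
    {a b : ℕ → ℂ} (h : IsFormallyConjugate F (quasiParabolicNormalForm θ a b)) (h0 : F 0 = 0)
    {m N : ℕ} (hm : m ≠ 0) (hN : m + 2 ≤ N)
    (ha : ∀ j, 2 ≤ j → j < m + 1 → a j = 0) (hb : ∀ j, 1 ≤ j → j < m → b j = 0) :
    ∃ φ : OpenPartialHomeomorph (Fin 2 → ℂ) (Fin 2 → ℂ), 0 ∈ φ.source ∧ φ 0 = 0 ∧
      HasLeadingTerms m N (unitEigenvalue θ) (a (m + 1)) (b m) fun y => φ (F (φ.symm y)) := by
  let c : ℕ → ℂ := fun j => if j = 0 then 0 else if j = 1 then 1 else a j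
  let d : ℕ → ℂ := fun j => if j = 0 then unitEigenvalue θ else b j
  have hc (z : ℂ) : ∑ j ∈ Finset.range (m + 2), c j * z ^ j = z + a (m + 1) * z ^ (m + 1) := by
    rw [sum_range_succ_eq_add (i := 1) (by omega) fun j hj hj1 => by grind]
    simp [c, hm]
  have hd (z : ℂ) : ∑ j ∈ Finset.range (m + 1), d j * z ^ j = unitEigenvalue θ + b m * z ^ m := by
    rw [sum_range_succ_eq_add (i := 0) (by omega) fun j hj hj0 => by grind]
    simp [d, hm]
  obtain ⟨φ, hsource, hφ0, herr⟩ := h.exists_chart h0 (N := N) (by omega)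
    (g := ![fun y => (∑ j ∈ Finset.range N, c j * y 0 ^ j) * y 1 ^ 0,
      fun y => (∑ j ∈ Finset.range N, d j * y 0 ^ j) * y 1 ^ 1])
    (Fin.forall_fin_two.mpr ⟨hasJet_sum_range_mul_pow N 0 c fun _ => rfl,
      hasJet_sum_range_mul_pow N 1 d fun _ => rfl⟩)
  have hcoord : Tendsto (fun y : Fin 2 → ℂ => y 0) (𝓝 0) (𝓝 0) := (continuous_apply 0).tendsto 0
  have htail₀ := (isBigO_sum_range_sub_sum_range c hN).comp_tendsto hcoord
  have htail₁ := ((isBigO_sum_range_sub_sum_range d (k := m + 1) (N := N) (by omega)).comp_tendsto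
    hcoord).mul (isBigO_refl (fun y : Fin 2 → ℂ => y 1) (𝓝 0)).norm_right
  refine ⟨φ, hsource, hφ0, ?_, ?_⟩
  · refine ((htail₀.add_add (herr 0)).congr_left fun y => ?_).congr_right fun y => ?_
    · simp only [Function.comp_apply, hc, Matrix.cons_val_zero, pow_zero]
      ring
    · simp
  · refine ((htail₁.add_add (herr 1)).congr_left fun y => ?_).congr_right fun y => ?_
    · simp only [Function.comp_apply, hd, Matrix.cons_val_one, Matrix.cons_val_fin_one, pow_one]
      ring
    · simp

/-! ### Basins of attraction and cusps -/

lemma IsBasinOfAttraction.image {D E U : Set (Fin 2 → ℂ)} {F G : (Fin 2 → ℂ) → Fin 2 → ℂ}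
    (hU : IsBasinOfAttraction E G U) {ψ : OpenPartialHomeomorph (Fin 2 → ℂ) (Fin 2 → ℂ)}
    (hψ : 0 ∈ ψ.source) (hψ0 : ψ 0 = 0) (hE : E ⊆ ψ.source) (hD : Set.MapsTo ψ E D)
    (hconj : ∀ y ∈ E, F (ψ y) = ψ (G y)) : IsBasinOfAttraction D F (ψ '' U) := by
  obtain ⟨B, hB, hBU⟩ := hU.exists_basis
  have hsource : U ⊆ ψ.source := hU.subset.trans hE
  have hcont : Tendsto ψ (𝓝 0) (𝓝 0) := by
    simpa only [ContinuousAt, hψ0] using ψ.continuousAt hψ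
  have hbasis : (𝓝 (0 : Fin 2 → ℂ)).HasBasis (fun Ω => Ω ∈ B ∧ Ω ⊆ ψ.source) (ψ '' ·) := by
    have := (hB.restrict_subset (ψ.open_source.mem_nhds hψ)).map ψ
    rwa [ψ.map_nhds_eq hψ, hψ0] at this
  refine ⟨hU.nonempty.image ψ, ψ.isOpen_image_of_subset_source hU.isOpen hsource,
    (hD.mono_left hU.subset).image_subset, ?_, _, hbasis.to_image_id, ?_⟩
  · exact hψ0 ▸ (ψ.continuousAt hψ).continuousWithinAt.mem_closure_image hU.zero_mem_closure
  rintro _ ⟨Ω, ⟨hΩ, hΩsource⟩, rfl⟩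
  obtain ⟨hmaps, hlim⟩ := hBU Ω hΩ
  rw [← ψ.injOn.image_inter hsource hΩsource]
  have hiter {y : Fin 2 → ℂ} (hy : y ∈ U ∩ Ω) (n : ℕ) : F^[n] (ψ y) = ψ (G^[n] y) := by
    induction n with
    | zero => rfl
    | succ n ih =>
      rw [Function.iterate_succ_apply', Function.iterate_succ_apply', ih,
        hconj _ (hU.subset (hmaps.iterate n hy).1)]
  refine ⟨?_, ?_⟩
  · rintro _ ⟨y, hy, rfl⟩
    exact ⟨G y, hmaps hy, (hconj y (hU.subset hy.1)).symm⟩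
  · rintro _ ⟨y, hy, rfl⟩
    exact (hcont.comp (hlim y hy)).congr fun n => (hiter hy n).symm

/-- The part over `S` of the region `‖w‖ < ‖z‖ ^ σ`, on which an error of order `N` in `(z, w)` has
order `σ N` in `z` alone. -/
def cusp (S : Set ℂ) (σ : ℝ) : Set (Fin 2 → ℂ) := {y | y 0 ∈ S ∧ ‖y 1‖ < ‖y 0‖ ^ σ}

lemma isOpen_cusp {S : Set ℂ} (hS : IsOpen S) {σ : ℝ} (hσ : 0 ≤ σ) : IsOpen (cusp S σ) :=
  (hS.preimage (continuous_apply 0)).inter <| isOpen_lt (continuous_apply 1).norm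
    ((continuous_apply 0).norm.rpow_const fun _ => Or.inr hσ)

lemma isPreconnected_cusp {S : Set ℂ} (hS : IsPreconnected S) (h0 : 0 ∉ S) {σ : ℝ} (hσ : 0 ≤ σ) :
    IsPreconnected (cusp S σ) := by
  have himage : cusp S σ = (fun p : ℂ × ℂ => ![p.1, (‖p.1‖ ^ σ : ℝ) * p.2]) ''
      (S ×ˢ Metric.ball 0 1) := by
    ext y
    constructor
    · rintro ⟨hy0, hy1⟩
      have hpos : 0 < ‖y 0‖ ^ σ := (norm_nonneg _).trans_lt hy1
      refine ⟨(y 0, y 1 / (‖y 0‖ ^ σ : ℝ)), ⟨hy0, ?_⟩, ?_⟩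
      · rwa [mem_ball_zero_iff, norm_div, Complex.norm_of_nonneg hpos.le, div_lt_one hpos]
      · ext i
        fin_cases i
        · rfl
        · exact mul_div_cancel₀ _ (Complex.ofReal_ne_zero.mpr hpos.ne')
    · rintro ⟨⟨z, s⟩, ⟨hz, hs⟩, rfl⟩
      have hpos : 0 < ‖z‖ ^ σ :=
        Real.rpow_pos_of_pos (norm_pos_iff.mpr (ne_of_mem_of_not_mem hz h0)) σ
      refine ⟨hz, ?_⟩
      simpa [abs_of_pos hpos, hpos] using hs
  rw [himage]
  refine (hS.prod (convex_ball 0 1).isPreconnected).image _ (Continuous.continuousOn ?_)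
  have : Continuous fun p : ℂ × ℂ => ‖p.1‖ ^ σ :=
    continuous_fst.norm.rpow_const fun _ => Or.inr hσ
  fun_prop

lemma zero_mem_closure_cusp {S : Set ℂ} (hS : 0 ∈ closure S) (h0 : 0 ∉ S) (σ : ℝ) :
    0 ∈ closure (cusp S σ) := by
  have haxis : Continuous fun z : ℂ => (![z, 0] : Fin 2 → ℂ) := by fun_prop
  have haxis0 : (![0, 0] : Fin 2 → ℂ) = 0 := by simp
  have hmaps : Set.MapsTo (fun z : ℂ => ![z, 0]) S (cusp S σ) := fun z hz => ⟨hz, by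
    simpa using Real.rpow_pos_of_pos (norm_pos_iff.mpr (ne_of_mem_of_not_mem hz h0)) σ⟩
  simpa only [haxis0] using map_mem_closure haxis hS hmaps

lemma hasBasis_nhds_zero_rpow {σ : ℝ} (hσ : 0 < σ) :
    (𝓝 (0 : Fin 2 → ℂ)).HasBasis (fun r : ℝ => 0 < r) fun r => {y | ‖y 0‖ < r ∧ ‖y 1‖ < r ^ σ} := by
  refine ⟨fun t => ⟨fun ht => ?_, ?_⟩⟩
  · obtain ⟨ε, hε, hball⟩ := Metric.mem_nhds_iff.mp ht
    refine ⟨min ε (ε ^ σ⁻¹), by positivity, fun y ⟨hy0, hy1⟩ => hball ?_⟩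
    rw [mem_ball_zero_iff, pi_norm_lt_iff hε, Fin.forall_fin_two]
    refine ⟨hy0.trans_le (min_le_left _ _), hy1.trans_le ?_⟩
    calc min ε (ε ^ σ⁻¹) ^ σ ≤ (ε ^ σ⁻¹) ^ σ := by gcongr; exact min_le_right _ _
      _ = ε := Real.rpow_inv_rpow hε.le hσ.ne'
  · rintro ⟨r, hr, hsub⟩
    refine mem_of_superset (inter_mem ?_ ?_) hsub
    · exact (isOpen_lt (continuous_apply 0).norm continuous_const).mem_nhds (by simpa using hr)
    · exact (isOpen_lt (continuous_apply 1).norm continuous_const).mem_nhds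
        (by simpa using Real.rpow_pos_of_pos hr σ)

lemma exists_forall_mem_cusp_of_eventually {σ : ℝ} (hσ : 0 < σ) {p : (Fin 2 → ℂ) → Prop}
    (hp : ∀ᶠ y in 𝓝[cusp Set.univ σ] 0, p y) :
    ∃ r > 0, ∀ y ∈ cusp Set.univ σ, ‖y 0‖ < r → p y := by
  obtain ⟨r, hr, hsub⟩ := (nhdsWithin_hasBasis (hasBasis_nhds_zero_rpow hσ) _).mem_iff.mp hp
  refine ⟨r, hr, fun y hy hyr => hsub ⟨⟨hyr, hy.2.trans ?_⟩, hy⟩⟩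
  exact Real.rpow_lt_rpow (norm_nonneg _) hyr hσ

lemma isBasinOfAttraction_cusp {D : Set (Fin 2 → ℂ)} {G : (Fin 2 → ℂ) → Fin 2 → ℂ} {S : Set ℂ}
    (hS : IsOpen S) (hS0 : 0 ∈ closure S) (h0 : 0 ∉ S) {σ : ℝ} (hσ : 0 < σ) (hD : cusp S σ ⊆ D)
    (hmaps : Set.MapsTo G (cusp S σ) (cusp S σ)) (hle : ∀ y ∈ cusp S σ, ‖G y 0‖ ≤ ‖y 0‖)
    (hlim : ∀ y ∈ cusp S σ, Tendsto (fun n => G^[n] y 0) atTop (𝓝 0)) :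
    IsBasinOfAttraction D G (cusp S σ) := by
  have hclosure : 0 ∈ closure (cusp S σ) := zero_mem_closure_cusp hS0 h0 σ
  refine ⟨closure_nonempty_iff.mp ⟨0, hclosure⟩, isOpen_cusp hS hσ.le, hD, hclosure, _,
    (hasBasis_nhds_zero_rpow hσ).to_image_id, ?_⟩
  rintro _ ⟨r, _, rfl⟩
  refine ⟨fun y ⟨hy, hyr, _⟩ => ?_, fun y ⟨hy, _⟩ => ?_⟩
  · have hlt : ‖G y 0‖ < r := (hle y hy).trans_lt hyr
    exact ⟨hmaps hy, hlt, (hmaps hy).2.trans (Real.rpow_lt_rpow (norm_nonneg _) hlt hσ)⟩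
  · rw [tendsto_pi_nhds, Fin.forall_fin_two]
    refine ⟨hlim y hy, squeeze_zero_norm (fun n => (hmaps.iterate n hy).2.le) ?_⟩
    simpa [hσ.ne'] using (hlim y hy).norm.rpow_const (Or.inr hσ.le)

lemma ne_zero_of_mem_cusp {S : Set ℂ} {σ : ℝ} (hσ : σ ≠ 0) {y : Fin 2 → ℂ} (hy : y ∈ cusp S σ) :
    y 0 ≠ 0 := by
  intro h
  simpa [h, hσ] using (norm_nonneg _).trans_lt hy.2

lemma tendsto_apply_zero_nhdsWithin_cusp {σ : ℝ} (hσ : σ ≠ 0) :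
    Tendsto (fun y : Fin 2 → ℂ => y 0) (𝓝[cusp Set.univ σ] 0) (𝓝[≠] 0) :=
  tendsto_nhdsWithin_of_tendsto_nhds_of_eventually_within _
    (tendsto_nhdsWithin_of_tendsto_nhds ((continuous_apply 0).tendsto 0))
    (eventually_nhdsWithin_of_forall fun _ => ne_zero_of_mem_cusp hσ)

lemma isBigO_norm_pow_cusp {σ : ℝ} (hσ : 0 < σ) (hσ1 : σ ≤ 1) {k N : ℕ} (hN : k ≤ σ * N) :
    (fun y : Fin 2 → ℂ => ‖y‖ ^ N) =O[𝓝[cusp Set.univ σ] 0] fun y => ‖y 0‖ ^ k := by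
  have hsmall : ∀ᶠ y in 𝓝[cusp Set.univ σ] (0 : Fin 2 → ℂ), ‖y 0‖ < 1 :=
    ((tendsto_apply_zero_nhdsWithin_cusp hσ.ne').mono_right
      nhdsWithin_le_nhds).norm.eventually_lt_const (by simp)
  refine IsBigO.of_norm_eventuallyLE ?_
  filter_upwards [hsmall, self_mem_nhdsWithin] with y hy1 hy
  have hy0 : 0 < ‖y 0‖ := norm_pos_iff.mpr (ne_zero_of_mem_cusp hσ.ne' hy)
  have hnorm : ‖y‖ ≤ ‖y 0‖ ^ σ := by
    rw [pi_norm_le_iff_of_nonneg (by positivity), Fin.forall_fin_two]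
    exact ⟨Real.self_le_rpow_of_le_one hy0.le hy1.le hσ1, hy.2.le⟩
  calc ‖‖y‖ ^ N‖ = ‖y‖ ^ N := by simp
    _ ≤ (‖y 0‖ ^ σ) ^ N := by gcongr
    _ = ‖y 0‖ ^ (σ * N) := (Real.rpow_mul_natCast hy0.le σ N).symm
    _ ≤ ‖y 0‖ ^ (k : ℝ) := Real.rpow_le_rpow_of_exponent_ge hy0 hy1.le hN
    _ = ‖y 0‖ ^ k := Real.rpow_natCast _ k

/-! ### The Fatou coordinate and petals -/

/-- The part to the right of the line `Re Z = R` of the cone of slope `k` around the positive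
real axis. -/
def coneTail (k R : ℝ) : Set ℂ := {Z | |Z.im| < k * Z.re ∧ R < Z.re}

lemma re_pos_of_mem_coneTail {k R : ℝ} (hk : 0 < k) {Z : ℂ} (hZ : Z ∈ coneTail k R) : 0 < Z.re :=
  pos_of_mul_pos_right ((abs_nonneg _).trans_lt hZ.1) hk.le

lemma norm_le_two_mul_re_of_mem_coneTail {k R : ℝ} (hk : 0 < k) (hk1 : k ≤ 1) {Z : ℂ}
    (hZ : Z ∈ coneTail k R) : ‖Z‖ ≤ 2 * Z.re := by
  have hre : 0 < Z.re := re_pos_of_mem_coneTail hk hZ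
  have him : |Z.im| ≤ Z.re := hZ.1.le.trans (mul_le_of_le_one_left hre.le hk1)
  linarith [Complex.norm_le_abs_re_add_abs_im Z, abs_of_pos hre]

lemma isOpen_coneTail (k R : ℝ) : IsOpen (coneTail k R) :=
  (isOpen_lt Complex.continuous_im.abs (continuous_const.mul Complex.continuous_re)).inter
    (isOpen_lt continuous_const Complex.continuous_re)

lemma convex_coneTail (k R : ℝ) : Convex ℝ (coneTail k R) := by
  have him : ConvexOn ℝ Set.univ fun Z : ℂ => |Z.im| :=
    (convexOn_norm convex_univ).comp_linearMap Complex.imLm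
  have hre : ConvexOn ℝ Set.univ fun Z : ℂ => -(k * Z.re) :=
    (-(k • Complex.reLm)).convexOn convex_univ
  have hcone : Convex ℝ {Z : ℂ | |Z.im| < k * Z.re} := by
    simpa [← sub_eq_add_neg] using (him.add hre).convex_lt 0
  exact hcone.inter (convex_halfSpace_re_gt R)

lemma mem_coneTail_of_norm_sub_add_one_le {k R : ℝ} (hk : 0 < k) (hk1 : k ≤ 1) {Z Z' : ℂ}
    (hZ : Z ∈ coneTail k R) (h : ‖Z' - (Z + 1)‖ ≤ k / 4) :
    Z' ∈ coneTail k R ∧ ‖Z‖ < ‖Z'‖ ∧ Z.re + 1 / 2 ≤ Z'.re := by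
  obtain ⟨η, rfl⟩ : ∃ η, Z' = Z + 1 + η := ⟨Z' - (Z + 1), by ring⟩
  rw [add_sub_cancel_left] at h
  have hre : 0 < Z.re := re_pos_of_mem_coneTail hk hZ
  have him : |Z.im| ≤ Z.re := hZ.1.le.trans (mul_le_of_le_one_left hre.le hk1)
  have hηre := abs_le.mp ((Complex.abs_re_le_norm η).trans h)
  have hηim := (Complex.abs_im_le_norm η).trans h
  have hre' : (Z + 1 + η).re = Z.re + 1 + η.re := by simp
  have him' : (Z + 1 + η).im = Z.im + η.im := by simp
  have hstep : Z.re + 1 / 2 ≤ (Z + 1 + η).re := by linarith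
  refine ⟨⟨?_, by linarith [hZ.2]⟩, ?_, hstep⟩
  · rw [him', hre']
    nlinarith [abs_add_le Z.im η.im, hZ.1]
  · have hcross : |Z.im * η.im| ≤ Z.re * (1 / 4) := by
      rw [abs_mul]
      exact mul_le_mul him (by linarith) (abs_nonneg _) hre.le
    rw [← sq_lt_sq₀ (norm_nonneg _) (norm_nonneg _), Complex.sq_norm, Complex.sq_norm,
      Complex.normSq_apply, Complex.normSq_apply, hre', him']
    nlinarith [abs_le.mp hcross, sq_nonneg η.im]

lemma norm_one_add_le (t : ℂ) : ‖1 + t‖ ≤ 1 + t.re + ‖t‖ ^ 2 / 2 := by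
  have hsq : ‖1 + t‖ ^ 2 = 1 + 2 * t.re + ‖t‖ ^ 2 := by
    simp only [Complex.sq_norm, Complex.normSq_apply, Complex.add_re, Complex.add_im,
      Complex.one_re, Complex.one_im]
    ring
  linarith [sq_nonneg (‖1 + t‖ - 1)]

lemma exists_forall_coneTail_norm_one_sub_div_le {κ : ℂ} (hκ : 0 < κ.re) :
    ∃ k, 0 < k ∧ k ≤ 1 ∧ ∃ c > 0, ∃ R, ∀ Z ∈ coneTail k R, ‖1 - κ / Z‖ ≤ 1 - c * ‖Z‖⁻¹ := by
  obtain ⟨k, hk, hk1, hkκ⟩ : ∃ k : ℝ, 0 < k ∧ k ≤ 1 ∧ k * |κ.im| < κ.re / 2 := by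
    have hlim : Tendsto (fun k : ℝ => k * |κ.im|) (𝓝[>] 0) (𝓝 0) :=
      tendsto_nhdsWithin_of_tendsto_nhds ((continuous_mul_const _).tendsto' _ _ (zero_mul _))
    exact (eventually_mem_nhdsWithin.and
      ((eventually_nhdsWithin_of_eventually_nhds (eventually_le_nhds one_pos)).and
        (hlim.eventually_lt_const (half_pos hκ)))).exists
  refine ⟨k, hk, hk1, κ.re / 8, by positivity, 4 * ‖κ‖ ^ 2 / κ.re, fun Z hZ => ?_⟩
  have hre : 0 < Z.re := re_pos_of_mem_coneTail hk hZ
  have hnorm : ‖Z‖ ≤ 2 * Z.re := norm_le_two_mul_re_of_mem_coneTail hk hk1 hZ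
  have hlarge : 4 * ‖κ‖ ^ 2 ≤ ‖Z‖ * κ.re :=
    (div_le_iff₀ hκ).mp (hZ.2.le.trans (Complex.re_le_norm Z))
  have hZ0 : 0 < ‖Z‖ := hre.trans_le (Complex.re_le_norm Z)
  have hcross : |κ.im * Z.im| ≤ κ.re / 2 * Z.re := by
    rw [abs_mul]
    nlinarith [abs_nonneg κ.im, hZ.1]
  have hinner : κ.re / 4 * ‖Z‖ ≤ κ.re * Z.re + κ.im * Z.im := by
    nlinarith [(abs_le.mp hcross).1]
  have hquot : κ.re / 4 * ‖Z‖⁻¹ ≤ (κ / Z).re := by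
    rw [Complex.div_re, ← add_div, Complex.normSq_eq_norm_sq, le_div_iff₀ (by positivity)]
    refine le_of_eq_of_le ?_ hinner
    field_simp
  have hsq : ‖κ / Z‖ ^ 2 / 2 ≤ κ.re / 8 * ‖Z‖⁻¹ := by
    rw [norm_div, div_pow, div_div, ← div_eq_mul_inv, div_le_div_iff₀ (by positivity) hZ0]
    nlinarith
  have := norm_one_add_le (-(κ / Z))
  rw [← sub_eq_add_neg, norm_neg, Complex.neg_re] at this
  linarith

/-- The Fatou coordinate `-1 / (m a z ^ m)` of the parabolic germ `z + a z ^ (m + 1) + ⋯`, in which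
it becomes a perturbation of the translation by `1`. -/
def fatouCoord (m : ℕ) (a z : ℂ) : ℂ := -(m * a * z ^ m)⁻¹

lemma norm_fatouCoord (m : ℕ) (a z : ℂ) : ‖fatouCoord m a z‖ = (m * ‖a‖ * ‖z‖ ^ m)⁻¹ := by
  simp [fatouCoord]

lemma norm_lt_of_lt_norm_fatouCoord {m : ℕ} (hm : m ≠ 0) {a : ℂ} (ha : a ≠ 0) {r : ℝ} (hr : 0 < r)
    {z : ℂ} (h : (m * ‖a‖ * r ^ m)⁻¹ < ‖fatouCoord m a z‖) : ‖z‖ < r := by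
  by_contra! hz
  have ha0 : 0 < ‖a‖ := norm_pos_iff.mpr ha
  rw [norm_fatouCoord] at h
  exact h.not_ge (by gcongr)

lemma tendsto_div_of_tendsto_sub_div_pow {α : Type*} {L : Filter α} {u u' : α → ℂ} {m : ℕ}
    (hm : m ≠ 0) {a : ℂ} (hu : Tendsto u L (𝓝[≠] 0))
    (h : Tendsto (fun x => (u' x - u x) / u x ^ (m + 1)) L (𝓝 a)) :
    Tendsto (fun x => u' x / u x) L (𝓝 1) := by
  have hpow : Tendsto (fun x => u x ^ m) L (𝓝 0) := by
    simpa [hm] using (hu.mono_right nhdsWithin_le_nhds).pow m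
  have hlim := (h.mul hpow).const_add 1
  rw [mul_zero, add_zero] at hlim
  refine hlim.congr' ?_
  filter_upwards [hu eventually_mem_nhdsWithin] with x hx
  have hx0 : u x ≠ 0 := hx
  field_simp
  ring

lemma tendsto_fatouCoord_sub_fatouCoord {α : Type*} {L : Filter α} {u u' : α → ℂ} {m : ℕ}
    (hm : m ≠ 0) {a : ℂ} (ha : a ≠ 0) (hu : Tendsto u L (𝓝[≠] 0))
    (h : Tendsto (fun x => (u' x - u x) / u x ^ (m + 1)) L (𝓝 a)) :
    Tendsto (fun x => fatouCoord m a (u' x) - fatouCoord m a (u x)) L (𝓝 1) := by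
  set g : ℂ → ℂ := fun t => (t ^ m)⁻¹
  have hg : HasDerivAt g (-m) 1 := by
    simpa using (hasDerivAt_pow m (1 : ℂ)).fun_inv (by simp)
  have hslope : Tendsto (fun x => dslope g 1 (u' x / u x)) L (𝓝 (-m)) := by
    have := (continuousAt_dslope_same.mpr hg.differentiableAt).tendsto
    rw [dslope_same, hg.deriv] at this
    exact this.comp (tendsto_div_of_tendsto_sub_div_pow hm hu h)
  have hmC : (m : ℂ) ≠ 0 := Nat.cast_ne_zero.mpr hm
  have hlim := (h.mul hslope).const_mul (-(m * a)⁻¹)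
  rw [show -(m * a)⁻¹ * (a * -m) = 1 by field_simp] at hlim
  refine hlim.congr' ?_
  filter_upwards [hu eventually_mem_nhdsWithin] with x hx
  have hx0 : u x ≠ 0 := hx
  have hdslope : (u' x / u x - 1) * dslope g 1 (u' x / u x) = g (u' x / u x) - 1 := by
    simpa [g] using sub_smul_dslope g 1 (u' x / u x)
  calc -(m * a)⁻¹ * ((u' x - u x) / u x ^ (m + 1) * dslope g 1 (u' x / u x))
      = -(m * a * u x ^ m)⁻¹ * ((u' x / u x - 1) * dslope g 1 (u' x / u x)) := by
        field_simp
        ring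
    _ = fatouCoord m a (u' x) - fatouCoord m a (u x) := by
        simp only [hdslope, g, fatouCoord, div_pow, inv_div, mul_inv]
        field_simp
        ring

lemma exists_forall_norm_add_mul_pow_le {m : ℕ} (hm : m ≠ 0) {a l b : ℂ} (hl : ‖l‖ ≤ 1)
    (hre : 0 < (b / (l * a)).re) :
    ∃ k, 0 < k ∧ k ≤ 1 ∧ ∃ c > 0, ∃ R, ∀ z, fatouCoord m a z ∈ coneTail k R →
      ‖l + b * z ^ m‖ ≤ 1 - c * ‖z‖ ^ m := by
  have hla : l * a ≠ 0 := by
    intro h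
    simp [h] at hre
  obtain ⟨hl0, ha0⟩ := mul_ne_zero_iff.mp hla
  have hmC : (m : ℂ) ≠ 0 := Nat.cast_ne_zero.mpr hm
  obtain ⟨k, hk, hk1, c, hc, R, hR⟩ :=
    exists_forall_coneTail_norm_one_sub_div_le (κ := b / (l * a) / m) (by
      rw [Complex.div_natCast_re]
      positivity)
  refine ⟨k, hk, hk1, c * (m * ‖a‖), by positivity, R, fun z hz => ?_⟩
  have hfactor : l + b * z ^ m = l * (1 - b / (l * a) / m / fatouCoord m a z) := by
    rw [fatouCoord, div_neg, div_inv_eq_mul]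
    field_simp
    ring
  calc ‖l + b * z ^ m‖ ≤ ‖1 - b / (l * a) / m / fatouCoord m a z‖ := by
        rw [hfactor, norm_mul]
        exact mul_le_of_le_one_left (norm_nonneg _) hl
    _ ≤ 1 - c * ‖fatouCoord m a z‖⁻¹ := hR _ hz
    _ = 1 - c * (m * ‖a‖) * ‖z‖ ^ m := by
        rw [norm_fatouCoord, inv_inv]
        ring

lemma arg_cpow_nat_inv {m : ℕ} (hm : m ≠ 0) {Z : ℂ} (hZ : Z ≠ 0) :
    (Z ^ (m : ℂ)⁻¹).arg = Z.arg / m := by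
  have him : (Complex.log Z * (m : ℂ)⁻¹).im = Z.arg / m := by
    rw [← div_eq_mul_inv, Complex.div_natCast_im, Complex.log_im]
  have hm1 : (1 : ℝ) ≤ m := Nat.one_le_cast.mpr (Nat.one_le_iff_ne_zero.mpr hm)
  have hm0 : (0 : ℝ) < m := one_pos.trans_le hm1
  rw [Complex.cpow_def_of_ne_zero hZ, ← Complex.log_im, Complex.log_exp, him]
  · rw [him, lt_div_iff₀ hm0]
    nlinarith [Complex.neg_pi_lt_arg Z, Real.pi_pos]
  · rw [him, div_le_iff₀ hm0]
    nlinarith [Complex.arg_le_pi Z, Real.pi_pos]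

lemma abs_arg_cpow_nat_inv_lt {m : ℕ} (hm : m ≠ 0) {Z : ℂ} (hZ : 0 < Z.re) :
    |(Z ^ (m : ℂ)⁻¹).arg| < Real.pi / (2 * m) := by
  have hZ0 : Z ≠ 0 := fun h => by simp [h] at hZ
  rw [arg_cpow_nat_inv hm hZ0, abs_div, Nat.abs_cast, ← div_div]
  gcongr
  exact Complex.abs_arg_lt_pi_div_two_iff.mpr (Or.inl hZ)

lemma pow_cpow_nat_inv_of_abs_arg_lt {m : ℕ} (hm : m ≠ 0) {ζ : ℂ} (h : |ζ.arg| < Real.pi / m) :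
    (ζ ^ m) ^ (m : ℂ)⁻¹ = ζ :=
  Complex.pow_cpow_nat_inv hm (abs_lt.mp h).1 (abs_lt.mp h).2.le

/-- The attracting petal around the ray through `ω`, where `ω ^ m = -1 / (m a)`, of the parabolic
germ `z + a z ^ (m + 1) + ⋯`. -/
def petal (m : ℕ) (a : ℂ) (k R : ℝ) (ω : ℂ) : Set ℂ :=
  {z | fatouCoord m a z ∈ coneTail k R ∧ |(ω / z).arg| < Real.pi / m}

lemma div_pow_eq_fatouCoord {m : ℕ} {a ω : ℂ} (hω : ω ^ m = -(m * a)⁻¹) (z : ℂ) :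
    (ω / z) ^ m = fatouCoord m a z := by
  rw [div_pow, hω, fatouCoord, mul_inv (m * a : ℂ), div_eq_mul_inv, neg_mul]

lemma zero_notMem_petal {m : ℕ} (hm : m ≠ 0) (a : ℂ) {k R : ℝ} (hk : 0 < k) (ω : ℂ) :
    0 ∉ petal m a k R ω := by
  intro h
  simpa [fatouCoord, hm] using re_pos_of_mem_coneTail hk h.1

lemma div_eq_fatouCoord_cpow {m : ℕ} (hm : m ≠ 0) {a ω z : ℂ} (hω : ω ^ m = -(m * a)⁻¹)
    (hz : |(ω / z).arg| < Real.pi / m) : ω / z = fatouCoord m a z ^ (m : ℂ)⁻¹ := by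
  rw [← div_pow_eq_fatouCoord hω, pow_cpow_nat_inv_of_abs_arg_lt hm hz]

lemma disjoint_petal {m : ℕ} (hm : m ≠ 0) {a : ℂ} {k R : ℝ} (hk : 0 < k) {ω ω' : ℂ}
    (hω : ω ^ m = -(m * a)⁻¹) (hω' : ω' ^ m = -(m * a)⁻¹) (hne : ω ≠ ω') :
    Disjoint (petal m a k R ω) (petal m a k R ω') := by
  refine Set.disjoint_left.mpr fun z hz hz' => hne ?_
  have hz0 : z ≠ 0 := ne_of_mem_of_not_mem hz (zero_notMem_petal hm a hk ω)
  rw [← div_left_inj' hz0, div_eq_fatouCoord_cpow hm hω hz.2, div_eq_fatouCoord_cpow hm hω' hz'.2]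

lemma isOpen_petal {m : ℕ} (hm : m ≠ 0) {a ω : ℂ} (hω : ω ^ m = -(m * a)⁻¹) {k R : ℝ}
    (hk : 0 < k) : IsOpen (petal m a k R ω) := by
  rw [isOpen_iff_mem_nhds]
  intro z hz
  have hz0 : z ≠ 0 := ne_of_mem_of_not_mem hz (zero_notMem_petal hm a hk ω)
  have hdiv : ContinuousAt (fun z => ω / z) z := continuousAt_const.div continuousAt_id hz0
  have hpi : Real.pi / m ≤ Real.pi :=
    div_le_self Real.pi_pos.le (Nat.one_le_cast.mpr (Nat.one_le_iff_ne_zero.mpr hm))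
  have hslit : ω / z ∈ Complex.slitPlane := by
    refine Complex.mem_slitPlane_iff_arg.mpr ⟨?_, ?_⟩
    · exact fun h => (hz.2.trans_le hpi).not_ge (h ▸ le_abs_self _)
    · intro h
      have := re_pos_of_mem_coneTail hk hz.1
      simp [← div_pow_eq_fatouCoord hω, h, hm] at this
  have hcone : ∀ᶠ x in 𝓝 z, fatouCoord m a x ∈ coneTail k R := by
    have hpow : ContinuousAt (fatouCoord m a) z :=
      (hdiv.pow m).congr (Eventually.of_forall (div_pow_eq_fatouCoord hω))
    exact hpow.eventually_mem ((isOpen_coneTail k R).mem_nhds hz.1)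
  have harg : ∀ᶠ x in 𝓝 z, |(ω / x).arg| < Real.pi / m :=
    ((Complex.continuousAt_arg hslit).comp (f := fun z => ω / z) hdiv).abs.eventually_lt
      continuousAt_const hz.2
  exact hcone.and harg

lemma petal_eq_image {m : ℕ} (hm : m ≠ 0) {a ω : ℂ} (hω0 : ω ≠ 0) (hω : ω ^ m = -(m * a)⁻¹)
    {k R : ℝ} (hk : 0 < k) :
    petal m a k R ω = (fun Z : ℂ => ω / Z ^ (m : ℂ)⁻¹) '' coneTail k R := by
  ext z
  constructor
  · intro hz
    refine ⟨_, hz.1, ?_⟩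
    beta_reduce
    rw [← div_eq_fatouCoord_cpow hm hω hz.2, div_div_cancel₀ hω0]
  · rintro ⟨Z, hZ, rfl⟩
    have hre : 0 < Z.re := re_pos_of_mem_coneTail hk hZ
    refine ⟨?_, ?_⟩
    · rwa [← div_pow_eq_fatouCoord hω, div_div_cancel₀ hω0, Complex.cpow_nat_inv_pow Z hm]
    · rw [div_div_cancel₀ hω0]
      refine (abs_arg_cpow_nat_inv_lt hm hre).trans_le ?_
      gcongr
      linarith [(Nat.cast_nonneg m : (0 : ℝ) ≤ m)]

lemma isPreconnected_petal {m : ℕ} (hm : m ≠ 0) {a ω : ℂ} (hω0 : ω ≠ 0)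
    (hω : ω ^ m = -(m * a)⁻¹) {k R : ℝ} (hk : 0 < k) : IsPreconnected (petal m a k R ω) := by
  rw [petal_eq_image hm hω0 hω hk]
  refine (convex_coneTail k R).isPreconnected.image _ fun Z hZ => ?_
  have hre : 0 < Z.re := re_pos_of_mem_coneTail hk hZ
  have hZ0 : Z ≠ 0 := fun h => by simp [h] at hre
  refine (continuousAt_const.div (continuousAt_id.cpow continuousAt_const (Or.inl hre))
    ?_).continuousWithinAt
  simp [Complex.cpow_eq_zero_iff, hZ0]

lemma zero_mem_closure_petal {m : ℕ} (hm : m ≠ 0) {a ω : ℂ} (hω0 : ω ≠ 0)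
    (hω : ω ^ m = -(m * a)⁻¹) {k R : ℝ} (hk : 0 < k) : 0 ∈ closure (petal m a k R ω) := by
  have hlim : Tendsto (fun t : ℝ => ω / (t : ℂ)) atTop (𝓝 0) := by
    simpa [div_eq_mul_inv] using
      ((Complex.continuous_ofReal.tendsto 0).comp tendsto_inv_atTop_zero).const_mul ω
  refine mem_closure_of_tendsto hlim ?_
  filter_upwards [eventually_gt_atTop 0, (tendsto_pow_atTop hm).eventually_gt_atTop R] with t ht htR
  refine ⟨?_, ?_⟩
  · rw [← div_pow_eq_fatouCoord hω, div_div_cancel₀ hω0, ← Complex.ofReal_pow]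
    refine ⟨?_, htR⟩
    rw [Complex.ofReal_im, Complex.ofReal_re, abs_zero]
    positivity
  · rw [div_div_cancel₀ hω0, Complex.arg_ofReal_of_nonneg ht.le, abs_zero]
    positivity

lemma mem_petal_of_norm_sub_add_one_le {m : ℕ} (hm : m ≠ 0) {a ω : ℂ} (hω : ω ^ m = -(m * a)⁻¹)
    {k R : ℝ} (hk : 0 < k) (hk1 : k ≤ 1) {z z' : ℂ} (hz : z ∈ petal m a k R ω)
    (hstep : ‖fatouCoord m a z' - (fatouCoord m a z + 1)‖ ≤ k / 4)
    (harg : |(z / z').arg| < Real.pi / (2 * m)) : z' ∈ petal m a k R ω := by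
  have hz' := (mem_coneTail_of_norm_sub_add_one_le hk hk1 hz.1 hstep).1
  have hre : 0 < (fatouCoord m a z).re := re_pos_of_mem_coneTail hk hz.1
  have hre' : 0 < (fatouCoord m a z').re := re_pos_of_mem_coneTail hk hz'
  have hz0 : z ≠ 0 := by
    rintro rfl
    simp [fatouCoord, hm] at hre
  have hz'0 : z' ≠ 0 := by
    rintro rfl
    simp [fatouCoord, hm] at hre'
  have hω0 : ω ≠ 0 := by
    rintro rfl
    simp [← div_pow_eq_fatouCoord hω, hm] at hre
  have hargz : |(ω / z).arg| < Real.pi / (2 * m) := by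
    rw [div_eq_fatouCoord_cpow hm hω hz.2]
    exact abs_arg_cpow_nat_inv_lt hm hre
  have hsum : |(ω / z).arg + (z / z').arg| < Real.pi / m :=
    ((abs_add_le _ _).trans_lt (add_lt_add hargz harg)).trans_eq (by field_simp; norm_num)
  have hpi : Real.pi / m ≤ Real.pi :=
    div_le_self Real.pi_pos.le (Nat.one_le_cast.mpr (Nat.one_le_iff_ne_zero.mpr hm))
  refine ⟨hz', ?_⟩
  rw [← div_mul_div_cancel₀ hz0, Complex.arg_mul (div_ne_zero hω0 hz0) (div_ne_zero hz0 hz'0)]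
  · exact hsum
  · exact Set.Ioo_subset_Ioc_self (abs_lt.mp (hsum.trans_le hpi))

/-! ### Dynamics on the cusps over the petals -/

lemma eventually_one_sub_mul_lt_rpow {A c σ : ℝ} (h : A * σ < c) :
    ∀ᶠ x in 𝓝[>] (0 : ℝ), 1 - c * x < (1 - A * x) ^ σ := by
  have hderiv : HasDerivAt (fun x : ℝ => (1 - A * x) ^ σ) (-(A * σ)) 0 := by
    simpa using (((hasDerivAt_id (0 : ℝ)).const_mul A).const_sub 1).rpow_const (p := σ) (by simp)
  have hslope := (hasDerivAt_iff_tendsto_slope_zero.mp hderiv).mono_left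
    (nhdsWithin_mono _ fun x (hx : 0 < x) => hx.ne')
  filter_upwards [hslope.eventually_const_lt (neg_lt_neg h), self_mem_nhdsWithin] with x hx hx0
  have hx0 : 0 < x := hx0
  simp only [zero_add, mul_zero, sub_zero, Real.one_rpow, smul_eq_mul] at hx
  rw [inv_mul_eq_div, lt_div_iff₀ hx0] at hx
  linarith

namespace HasLeadingTerms

variable {m N : ℕ} {l a b : ℂ} {G : (Fin 2 → ℂ) → Fin 2 → ℂ} {σ : ℝ}

lemma tendsto_fst (hG : HasLeadingTerms m N l a b G) (hσ : 0 < σ) (hσ1 : σ ≤ 1)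
    (hN : m + 2 ≤ σ * N) :
    Tendsto (fun y => (G y 0 - y 0) / y 0 ^ (m + 1)) (𝓝[cusp Set.univ σ] 0) (𝓝 a) := by
  have hy : Tendsto (fun y : Fin 2 → ℂ => y 0) (𝓝[cusp Set.univ σ] 0) (𝓝[≠] 0) :=
    tendsto_apply_zero_nhdsWithin_cusp hσ.ne'
  have hO : (fun y => G y 0 - (y 0 + a * y 0 ^ (m + 1)))
      =O[𝓝[cusp Set.univ σ] 0] fun y => y 0 ^ (m + 2) := by
    refine (hG.fst.mono nhdsWithin_le_nhds).trans ?_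
    simp_rw [← isBigO_norm_right (g' := fun y : Fin 2 → ℂ => y 0 ^ (m + 2)), norm_pow]
    exact (isBigO_refl _ _).add (isBigO_norm_pow_cusp hσ hσ1 (by exact_mod_cast hN))
  have ho : (fun y : Fin 2 → ℂ => y 0 ^ (m + 2))
      =o[𝓝[cusp Set.univ σ] 0] fun y => y 0 ^ (m + 1) :=
    (isLittleO_pow_pow (Nat.lt_succ_self (m + 1))).comp_tendsto (hy.mono_right nhdsWithin_le_nhds)
  have hlim := (hO.trans_isLittleO ho).tendsto_div_nhds_zero.add_const a
  rw [zero_add] at hlim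
  refine hlim.congr' ?_
  filter_upwards [hy eventually_mem_nhdsWithin] with y hy0
  have hy0 : y 0 ≠ 0 := hy0
  field_simp
  ring

lemma isLittleO_snd (hG : HasLeadingTerms m N l a b G) (hσ : 0 < σ) (hσ1 : σ ≤ 1)
    (hN : m + 2 ≤ σ * N) :
    (fun y => G y 1 - (l + b * y 0 ^ m) * y 1)
      =o[𝓝[cusp Set.univ σ] 0] fun y => ‖y 0‖ ^ m * ‖y 0‖ ^ σ := by
  have hy : Tendsto (fun y : Fin 2 → ℂ => ‖y 0‖) (𝓝[cusp Set.univ σ] 0) (𝓝 0) := by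
    simpa using ((tendsto_apply_zero_nhdsWithin_cusp hσ.ne').mono_right nhdsWithin_le_nhds).norm
  have hsnd : (fun y : Fin 2 → ℂ => ‖y 1‖) =O[𝓝[cusp Set.univ σ] 0] fun y => ‖y 0‖ ^ σ := by
    refine IsBigO.of_norm_eventuallyLE (eventually_nhdsWithin_of_forall fun y hy => ?_)
    simpa using hy.2.le
  have hfst : (fun y : Fin 2 → ℂ => ‖y 0‖) =O[𝓝[cusp Set.univ σ] 0] fun y => ‖y 0‖ ^ σ := by
    refine IsBigO.of_norm_eventuallyLE ?_
    filter_upwards [hy.eventually_le_const one_pos] with y hy1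
    rw [norm_norm]
    exact Real.self_le_rpow_of_le_one (norm_nonneg _) hy1 hσ1
  have hpow : (fun y : Fin 2 → ℂ => ‖y‖ ^ N)
      =O[𝓝[cusp Set.univ σ] 0] fun y => ‖y 0‖ ^ (m + 1) * ‖y 0‖ ^ σ := by
    refine (isBigO_norm_pow_cusp hσ hσ1 (k := m + 2) (by exact_mod_cast hN)).trans ?_
    simp_rw [pow_succ _ (m + 1)]
    exact (isBigO_refl _ _).mul hfst
  have ho : (fun y : Fin 2 → ℂ => ‖y 0‖ ^ (m + 1)) =o[𝓝[cusp Set.univ σ] 0] fun y => ‖y 0‖ ^ m :=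
    (isLittleO_pow_pow (Nat.lt_succ_self m)).comp_tendsto hy
  exact ((hG.snd.mono nhdsWithin_le_nhds).trans
    (((isBigO_refl _ _).mul hsnd).add hpow)).trans_isLittleO (ho.mul_isBigO (isBigO_refl _ _))

lemma eventually_norm_fst_ge (hG : HasLeadingTerms m N l a b G) (ha : a ≠ 0) (hσ : 0 < σ)
    (hσ1 : σ ≤ 1) (hN : m + 2 ≤ σ * N) :
    ∀ᶠ y in 𝓝[cusp Set.univ σ] 0, (1 - 2 * ‖a‖ * ‖y 0‖ ^ m) * ‖y 0‖ ≤ ‖G y 0‖ := by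
  have hlt : ‖a‖ < 2 * ‖a‖ := lt_two_mul_self (norm_pos_iff.mpr ha)
  filter_upwards [(hG.tendsto_fst hσ hσ1 hN).norm.eventually_le_const hlt,
    self_mem_nhdsWithin] with y hle hy
  have hy0 : 0 < ‖y 0‖ := norm_pos_iff.mpr (ne_zero_of_mem_cusp hσ.ne' hy)
  rw [norm_div, norm_pow, div_le_iff₀ (by positivity), pow_succ] at hle
  have htri : ‖y 0‖ ≤ ‖G y 0‖ + ‖G y 0 - y 0‖ := norm_le_norm_add_norm_sub _ _
  linarith

lemma eventually_norm_snd_lt (hG : HasLeadingTerms m N l a b G) (hm : m ≠ 0) (ha : a ≠ 0)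
    (hσ : 0 < σ) (hσ1 : σ ≤ 1) (hN : m + 2 ≤ σ * N) {c : ℝ} (hc : 2 * ‖a‖ * σ < c) :
    ∀ᶠ y in 𝓝[cusp Set.univ σ] 0, ‖l + b * y 0 ^ m‖ ≤ 1 - c * ‖y 0‖ ^ m →
      ‖G y 1‖ < ‖G y 0‖ ^ σ := by
  obtain ⟨c', hσc', hc'⟩ := exists_between hc
  have hx : Tendsto (fun y : Fin 2 → ℂ => ‖y 0‖ ^ m) (𝓝[cusp Set.univ σ] 0) (𝓝[>] 0) := by
    refine tendsto_nhdsWithin_iff.mpr ⟨?_, ?_⟩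
    · simpa [hm] using ((tendsto_apply_zero_nhdsWithin_cusp hσ.ne').mono_right
        nhdsWithin_le_nhds).norm.pow m
    · exact eventually_nhdsWithin_of_forall fun y hy =>
        pow_pos (norm_pos_iff.mpr (ne_zero_of_mem_cusp hσ.ne' hy)) m
  have hpos : ∀ᶠ x in 𝓝[>] (0 : ℝ), 0 ≤ 1 - 2 * ‖a‖ * x :=
    ((Continuous.tendsto' (by fun_prop) 0 1 (by simp)).mono_left
      nhdsWithin_le_nhds).eventually_const_le one_pos
  filter_upwards [hG.eventually_norm_fst_ge ha hσ hσ1 hN,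
    (hG.isLittleO_snd hσ hσ1 hN).bound (sub_pos.mpr hc'),
    hx.eventually (eventually_one_sub_mul_lt_rpow hσc'), hx.eventually hpos,
    self_mem_nhdsWithin] with y hfst hsnd hrpow hnonneg hy hcontr
  have hy0 : 0 < ‖y 0‖ ^ σ := (norm_nonneg _).trans_lt hy.2
  rw [norm_mul, norm_pow, norm_norm, Real.norm_of_nonneg hy0.le] at hsnd
  calc ‖G y 1‖ ≤ ‖l + b * y 0 ^ m‖ * ‖y 1‖ + ‖G y 1 - (l + b * y 0 ^ m) * y 1‖ := by
        rw [← norm_mul]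
        exact norm_le_norm_add_norm_sub' _ _
    _ ≤ (1 - c * ‖y 0‖ ^ m) * ‖y 0‖ ^ σ + (c - c') * (‖y 0‖ ^ m * ‖y 0‖ ^ σ) :=
        add_le_add (mul_le_mul hcontr hy.2.le (norm_nonneg _) ((norm_nonneg _).trans hcontr)) hsnd
    _ = (1 - c' * ‖y 0‖ ^ m) * ‖y 0‖ ^ σ := by ring
    _ < (1 - 2 * ‖a‖ * ‖y 0‖ ^ m) ^ σ * ‖y 0‖ ^ σ := by gcongr
    _ = ((1 - 2 * ‖a‖ * ‖y 0‖ ^ m) * ‖y 0‖) ^ σ := (Real.mul_rpow hnonneg (norm_nonneg _)).symm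
    _ ≤ ‖G y 0‖ ^ σ := Real.rpow_le_rpow (by positivity) hfst hσ.le

end HasLeadingTerms

lemma HasLeadingTerms.eventually_step {m N : ℕ} {l a b : ℂ} {G : (Fin 2 → ℂ) → Fin 2 → ℂ} {σ : ℝ}
    (hG : HasLeadingTerms m N l a b G) (hm : m ≠ 0) (ha : a ≠ 0) (hσ : 0 < σ) (hσ1 : σ ≤ 1)
    (hN : m + 2 ≤ σ * N) {ε : ℝ} (hε : 0 < ε) :
    ∀ᶠ y in 𝓝[cusp Set.univ σ] 0,
      ‖fatouCoord m a (G y 0) - (fatouCoord m a (y 0) + 1)‖ ≤ ε ∧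
        |(y 0 / G y 0).arg| < Real.pi / (2 * m) := by
  have hy : Tendsto (fun y : Fin 2 → ℂ => y 0) (𝓝[cusp Set.univ σ] 0) (𝓝[≠] 0) :=
    tendsto_apply_zero_nhdsWithin_cusp hσ.ne'
  have hfst := hG.tendsto_fst hσ hσ1 hN
  have hfatou : Tendsto (fun y => ‖fatouCoord m a (G y 0) - (fatouCoord m a (y 0) + 1)‖)
      (𝓝[cusp Set.univ σ] 0) (𝓝 0) := by
    simpa only [sub_sub, sub_self, norm_zero] using
      ((tendsto_fatouCoord_sub_fatouCoord hm ha hy hfst).sub_const 1).norm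
  have harg : Tendsto (fun y => |(y 0 / G y 0).arg|) (𝓝[cusp Set.univ σ] 0) (𝓝 0) := by
    have hdiv : Tendsto (fun y => y 0 / G y 0) (𝓝[cusp Set.univ σ] 0) (𝓝 1) := by
      simpa only [inv_div, inv_one] using
        (tendsto_div_of_tendsto_sub_div_pow hm hy hfst).inv₀ one_ne_zero
    simpa using ((Complex.continuousAt_arg Complex.one_mem_slitPlane).tendsto.comp hdiv).abs
  exact (hfatou.eventually_le_const hε).and (harg.eventually_lt_const (by positivity))

section PetalBasin

variable {m : ℕ} {a ω : ℂ} {k R σ : ℝ} {G : (Fin 2 → ℂ) → Fin 2 → ℂ}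

lemma tendsto_iterate_of_mapsTo_cusp_petal (hm : m ≠ 0) (ha : a ≠ 0) (hk : 0 < k) (hk1 : k ≤ 1)
    (hmaps : Set.MapsTo G (cusp (petal m a k R ω) σ) (cusp (petal m a k R ω) σ))
    (hstep : ∀ y ∈ cusp (petal m a k R ω) σ,
      ‖fatouCoord m a (G y 0) - (fatouCoord m a (y 0) + 1)‖ ≤ k / 4)
    {y : Fin 2 → ℂ} (hy : y ∈ cusp (petal m a k R ω) σ) :
    Tendsto (fun n => G^[n] y 0) atTop (𝓝 0) := by
  have hiter : ∀ n : ℕ, (fatouCoord m a (y 0)).re + n / 2 ≤ (fatouCoord m a (G^[n] y 0)).re := by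
    intro n
    induction n with
    | zero => simp
    | succ n ih =>
      have hmem := hmaps.iterate n hy
      have := (mem_coneTail_of_norm_sub_add_one_le hk hk1 hmem.1.1 (hstep _ hmem)).2.2
      rw [Function.iterate_succ_apply']
      push_cast
      linarith
  have hgrow : Tendsto (fun n : ℕ => (fatouCoord m a (y 0)).re + (n : ℝ) / 2) atTop atTop :=
    tendsto_atTop_add_const_left _ _ (tendsto_natCast_atTop_atTop.atTop_div_const two_pos)
  refine NormedAddGroup.tendsto_nhds_zero.mpr fun ε hε => ?_
  filter_upwards [hgrow.eventually_gt_atTop (m * ‖a‖ * ε ^ m)⁻¹] with n hn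
  exact norm_lt_of_lt_norm_fatouCoord hm ha hε
    ((hn.trans_le (hiter n)).trans_le (Complex.re_le_norm _))

lemma isBasinOfAttraction_cusp_petal {D : Set (Fin 2 → ℂ)} (hm : m ≠ 0) (ha : a ≠ 0)
    (hω0 : ω ≠ 0) (hω : ω ^ m = -(m * a)⁻¹) (hk : 0 < k) (hk1 : k ≤ 1) (hσ : 0 < σ)
    (hD : cusp (petal m a k R ω) σ ⊆ D)
    (hstep : ∀ y ∈ cusp (petal m a k R ω) σ,
      ‖fatouCoord m a (G y 0) - (fatouCoord m a (y 0) + 1)‖ ≤ k / 4)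
    (harg : ∀ y ∈ cusp (petal m a k R ω) σ, |(y 0 / G y 0).arg| < Real.pi / (2 * m))
    (hsnd : ∀ y ∈ cusp (petal m a k R ω) σ, ‖G y 1‖ < ‖G y 0‖ ^ σ) :
    IsBasinOfAttraction D G (cusp (petal m a k R ω) σ) := by
  have hmaps : Set.MapsTo G (cusp (petal m a k R ω) σ) (cusp (petal m a k R ω) σ) :=
    fun y hy => ⟨mem_petal_of_norm_sub_add_one_le hm hω hk hk1 hy.1 (hstep y hy) (harg y hy),
      hsnd y hy⟩
  refine isBasinOfAttraction_cusp (isOpen_petal hm hω hk) (zero_mem_closure_petal hm hω0 hω hk)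
    (zero_notMem_petal hm a hk ω) hσ hD hmaps (fun y hy => ?_)
    (fun y hy => tendsto_iterate_of_mapsTo_cusp_petal hm ha hk hk1 hmaps hstep hy)
  have hlt := (mem_coneTail_of_norm_sub_add_one_le hk hk1 hy.1.1 (hstep y hy)).2.1
  refine (norm_lt_of_lt_norm_fatouCoord hm ha
    (norm_pos_iff.mpr (ne_zero_of_mem_cusp hσ.ne' hy)) ?_).le
  rwa [norm_fatouCoord m a (y 0)] at hlt

end PetalBasin

lemma exists_injective_pow_eq {K : Type*} [Field K] [IsAlgClosed K] {m : ℕ} (hm : (m : K) ≠ 0)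
    {c : K} (hc : c ≠ 0) : ∃ ω : Fin m → K, Function.Injective ω ∧ ∀ i, ω i ^ m = c := by
  have : NeZero (m : K) := ⟨hm⟩
  have hm0 : 0 < m := Nat.pos_of_ne_zero fun h => hm (by rw [h, Nat.cast_zero])
  obtain ⟨ω₀, hω₀⟩ := IsAlgClosed.exists_pow_nat_eq c hm0
  have hω₀0 : ω₀ ≠ 0 := by
    rintro rfl
    exact hc (by rw [← hω₀, zero_pow hm0.ne'])
  obtain ⟨ζ, hζ⟩ := HasEnoughRootsOfUnity.exists_primitiveRoot K m
  refine ⟨fun i => ω₀ * ζ ^ (i : ℕ), fun i j hij => ?_, fun i => ?_⟩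
  · exact Fin.ext (hζ.pow_inj i.2 j.2 (mul_left_cancel₀ hω₀0 hij))
  · rw [mul_pow, hω₀, pow_right_comm, hζ.pow_eq_one, one_pow, mul_one]

lemma exists_basins_of_forall_cusp {m : ℕ} {a : ℂ} {k r R₀ σ : ℝ} {D : Set (Fin 2 → ℂ)}
    {G : (Fin 2 → ℂ) → Fin 2 → ℂ} (hm : m ≠ 0) (ha : a ≠ 0) (hk : 0 < k) (hk1 : k ≤ 1)
    (hσ : 0 < σ) (hr : 0 < r)
    (h : ∀ y ∈ cusp Set.univ σ, ‖y 0‖ < r → fatouCoord m a (y 0) ∈ coneTail k R₀ →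
      y ∈ D ∧ ‖fatouCoord m a (G y 0) - (fatouCoord m a (y 0) + 1)‖ ≤ k / 4 ∧
        |(y 0 / G y 0).arg| < Real.pi / (2 * m) ∧ ‖G y 1‖ < ‖G y 0‖ ^ σ) :
    ∃ U : Fin m → Set (Fin 2 → ℂ), (∀ i, IsConnected (U i) ∧ IsBasinOfAttraction D G (U i)) ∧
      Pairwise (Function.onFun Disjoint U) := by
  have hc : -(m * a)⁻¹ ≠ 0 := neg_ne_zero.mpr (inv_ne_zero (mul_ne_zero (mod_cast hm) ha))
  obtain ⟨ω, hinj, hω⟩ := exists_injective_pow_eq (Nat.cast_ne_zero.mpr hm) hc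
  have hω0 : ∀ i, ω i ≠ 0 := fun i hi => hc (by rw [← hω i, hi, zero_pow hm])
  set R : ℝ := max R₀ (m * ‖a‖ * r ^ m)⁻¹
  have hU : ∀ i, ∀ y ∈ cusp (petal m a k R (ω i)) σ, y ∈ D ∧
      ‖fatouCoord m a (G y 0) - (fatouCoord m a (y 0) + 1)‖ ≤ k / 4 ∧
        |(y 0 / G y 0).arg| < Real.pi / (2 * m) ∧ ‖G y 1‖ < ‖G y 0‖ ^ σ := by
    intro i y hy
    have hsmall : ‖y 0‖ < r := norm_lt_of_lt_norm_fatouCoord hm ha hr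
      (((le_max_right _ _).trans_lt hy.1.1.2).trans_le (Complex.re_le_norm _))
    exact h y ⟨Set.mem_univ _, hy.2⟩ hsmall ⟨hy.1.1.1, (le_max_left _ _).trans_lt hy.1.1.2⟩
  have hbasin : ∀ i, IsBasinOfAttraction D G (cusp (petal m a k R (ω i)) σ) := fun i =>
    isBasinOfAttraction_cusp_petal hm ha (hω0 i) (hω i) hk hk1 hσ (fun y hy => (hU i y hy).1)
      (fun y hy => (hU i y hy).2.1) (fun y hy => (hU i y hy).2.2.1) fun y hy => (hU i y hy).2.2.2
  refine ⟨fun i => cusp (petal m a k R (ω i)) σ, fun i => ⟨⟨(hbasin i).nonempty, ?_⟩, hbasin i⟩,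
    fun i j hij => ?_⟩
  · exact isPreconnected_cusp (isPreconnected_petal hm (hω0 i) (hω i) hk)
      (zero_notMem_petal hm a hk (ω i)) hσ.le
  · exact Set.disjoint_left.mpr fun y hy hy' =>
      Set.disjoint_left.mp (disjoint_petal hm hk (hω i) (hω j) (hinj.ne hij)) hy.1 hy'.1

theorem HasLeadingTerms.exists_basins {m : ℕ} (hm : m ≠ 0) {l a b : ℂ} (hl : ‖l‖ ≤ 1)
    (hre : 0 < (b / (l * a)).re) :
    ∃ N, m + 2 ≤ N ∧ ∀ G, HasLeadingTerms m N l a b G → ∀ D ∈ 𝓝 (0 : Fin 2 → ℂ),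
      ∃ U : Fin m → Set (Fin 2 → ℂ), (∀ i, IsConnected (U i) ∧ IsBasinOfAttraction D G (U i)) ∧
        Pairwise (Function.onFun Disjoint U) := by
  have ha : a ≠ 0 := by
    rintro rfl
    simp at hre
  obtain ⟨k, hk, hk1, c, hc, R₀, hcontr⟩ := exists_forall_norm_add_mul_pow_le hm hl hre
  obtain ⟨σ, hσ, hσ1, hσc⟩ : ∃ σ : ℝ, 0 < σ ∧ σ ≤ 1 ∧ 2 * ‖a‖ * σ < c := by
    have hlim : Tendsto (fun σ : ℝ => 2 * ‖a‖ * σ) (𝓝[>] 0) (𝓝 0) :=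
      tendsto_nhdsWithin_of_tendsto_nhds ((continuous_const_mul _).tendsto' _ _ (mul_zero _))
    exact (eventually_mem_nhdsWithin.and
      ((eventually_nhdsWithin_of_eventually_nhds (eventually_le_nhds one_pos)).and
        (hlim.eventually_lt_const hc))).exists
  obtain ⟨N, hN⟩ := exists_nat_ge ((m + 2) / σ)
  rw [div_le_iff₀' hσ] at hN
  refine ⟨N, ?_, fun G hG D hD => ?_⟩
  · have : (m + 2 : ℝ) ≤ N := hN.trans (mul_le_of_le_one_left N.cast_nonneg hσ1)
    exact_mod_cast this
  obtain ⟨r, hr, hgood⟩ := exists_forall_mem_cusp_of_eventually hσ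
    ((eventually_nhdsWithin_of_eventually_nhds hD).and
      ((hG.eventually_step hm ha hσ hσ1 hN (ε := k / 4) (by positivity)).and
        (hG.eventually_norm_snd_lt hm ha hσ hσ1 hN hσc)))
  refine exists_basins_of_forall_cusp (R₀ := R₀) hm ha hk hk1 hσ hr fun y hy hyr hcone => ?_
  obtain ⟨hyD, ⟨hstep, harg⟩, hsnd⟩ := hgood y hy hyr
  exact ⟨hyD, hstep, harg, hsnd (hcontr _ hcone)⟩

lemma norm_unitEigenvalue (θ : ℝ) : ‖unitEigenvalue θ‖ = 1 := by
  have : unitEigenvalue θ = Complex.exp ((2 * Real.pi * θ : ℝ) * Complex.I) := by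
    rw [unitEigenvalue]
    push_cast
    ring_nf
  rw [this, Complex.norm_exp_ofReal_mul_I]

lemma IsFormallyConjugate.exists_basins {θ : ℝ} {D : Set (Fin 2 → ℂ)}
    {F : (Fin 2 → ℂ) → Fin 2 → ℂ} {a b : ℕ → ℂ} {m : ℕ}
    (h : IsFormallyConjugate F (quasiParabolicNormalForm θ a b)) (hD : D ∈ 𝓝 0) (h0 : F 0 = 0)
    (hm : m ≠ 0) (ha : ∀ j, 2 ≤ j → j < m + 1 → a j = 0) (hb : ∀ j, 1 ≤ j → j < m → b j = 0)
    (hre : 0 < (b m / (unitEigenvalue θ * a (m + 1))).re) :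
    ∃ U : Fin m → Set (Fin 2 → ℂ), (∀ i, IsConnected (U i) ∧ IsBasinOfAttraction D F (U i)) ∧
      Pairwise (Function.onFun Disjoint U) := by
  obtain ⟨N, hN, hbasins⟩ := HasLeadingTerms.exists_basins hm (norm_unitEigenvalue θ).le hre
  obtain ⟨φ, hφ, hφ0, hG⟩ := h.exists_hasLeadingTerms h0 hm hN ha hb
  have hφt : 0 ∈ φ.symm.source := hφ0 ▸ φ.map_source hφ
  have hφs : φ.symm 0 = 0 := by rw [← hφ0, φ.left_inv hφ, hφ0]
  have hlim : Tendsto φ.symm (𝓝 0) (𝓝 0) := by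
    simpa only [hφs] using (φ.symm.continuousAt hφt).tendsto
  obtain ⟨P, -, hP, -⟩ := h
  set E : Set (Fin 2 → ℂ) := {y | y ∈ φ.symm.source ∧ φ.symm y ∈ D ∧ F (φ.symm y) ∈ φ.source}
  have hE : E ∈ 𝓝 0 :=
    (φ.symm.open_source.eventually_mem hφt).and ((hlim.eventually_mem hD).and
      (((hP.tendsto_zero h0).comp hlim).eventually_mem (φ.open_source.mem_nhds hφ)))
  obtain ⟨U, hU, hdisj⟩ := hbasins _ hG E hE
  have hsource : ∀ i, U i ⊆ φ.symm.source := fun i => (hU i).2.subset.trans fun _ hy => hy.1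
  refine ⟨fun i => φ.symm '' U i, fun i => ⟨?_, ?_⟩, fun i j hij => ?_⟩
  · exact (hU i).1.image _ (φ.symm.continuousOn.mono (hsource i))
  · exact (hU i).2.image hφt hφs (fun _ hy => hy.1) (fun _ hy => hy.2.1)
      fun y hy => (φ.left_inv hy.2.2).symm
  · exact (hdisj hij).image φ.symm.injOn (hsource i) (hsource j)

lemma two_le_normalFormNu (a : ℕ → ℂ) : 2 ≤ normalFormNu a :=
  le_iInf₂ fun _ hj => by exact_mod_cast hj.1

lemma eq_zero_of_lt_normalFormNu {a : ℕ → ℂ} {j : ℕ} (hj : 2 ≤ j) (h : j < normalFormNu a) :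
    a j = 0 :=
  by_contra fun hne => h.not_ge (iInf₂_le j ⟨hj, hne⟩)

lemma eq_zero_of_lt_normalFormMu {b : ℕ → ℂ} {j : ℕ} (hj : 1 ≤ j) (h : j < normalFormMu b) :
    b j = 0 :=
  by_contra fun hne => h.not_ge (iInf₂_le j ⟨hj, hne⟩)

theorem corollary6p3_general {θ : ℝ} {D : Set (Fin 2 → ℂ)} {F : (Fin 2 → ℂ) → (Fin 2 → ℂ)}
    (hD : D ∈ 𝓝 0) (h0 : F 0 = 0) {a b : ℕ → ℂ}
    (hconj : IsFormallyConjugate F (quasiParabolicNormalForm θ a b))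
    (hsep : normalFormNu a ≤ normalFormMu b + 1) {ν : ℕ} (hν : normalFormNu a = ν)
    (hre : 0 < (b (ν - 1) / (unitEigenvalue θ * a ν)).re) :
    ∃ U : Fin (ν - 1) → Set (Fin 2 → ℂ),
      (∀ i, IsConnected (U i) ∧ IsBasinOfAttraction D F (U i)) ∧
        Pairwise (Function.onFun Disjoint U) := by
  have hν2 : 2 ≤ ν := by exact_mod_cast hν ▸ two_le_normalFormNu a
  obtain ⟨m, rfl⟩ : ∃ m, ν = m + 1 := ⟨ν - 1, by omega⟩
  have hm : (m : ℕ∞) ≤ normalFormMu b := by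
    rw [hν, Nat.cast_succ] at hsep
    exact (ENat.add_le_add_iff_right ENat.one_ne_top).mp hsep
  refine hconj.exists_basins hD h0 (by omega) (fun j hj hjm => ?_) (fun j hj hjm => ?_) hre
  · exact eq_zero_of_lt_normalFormNu hj (by rw [hν]; exact_mod_cast hjm)
  · exact eq_zero_of_lt_normalFormMu hj (lt_of_lt_of_le (mod_cast hjm) hm)

end

theorem corollary6p3 (θ : ℝ) (hθ : Irrational θ)
    (D : Set (Fin 2 → ℂ)) (F : (Fin 2 → ℂ) → (Fin 2 → ℂ))
    (hF : IsQuasiParabolic θ D F) (hsep : IsDynamicallySeparating θ F)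
    (a b : ℕ → ℂ) (hconj : IsFormallyConjugate F (quasiParabolicNormalForm θ a b))
    (ν : ℕ) (hν : normalFormNu a = ν)
    (hre : 0 < (b (ν - 1) / (unitEigenvalue θ * a ν)).re) :
    ∃ U : Fin (ν - 1) → Set (Fin 2 → ℂ),
      (∀ i, IsConnected (U i) ∧ IsBasinOfAttraction D F (U i)) ∧
        Pairwise (Function.onFun Disjoint U) :=
  corollary6p3_general (hF.isOpen.mem_nhds hF.zero_mem) hF.map_zero hconj (hsep.2 a b hconj).2 hν
    hre
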